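/- Let $M$ be a finite-dimensional smooth manifold with tangent bundle projection $\tau:TM\to M$, and let $\Gamma$ be a SODE on $M$, i.e. a smooth vector field on $TM$ of the local form $\Gamma=\dot q^i\,\partial/\partial q^i+f^i(q,\dot q)\,\partial/\partial\dot q^i$ (so its integral curves are lifts $\dot c$ of curves $c$ in $M$, called base integral curves). Put $\Gamma^i_j=-\tfrac12\,\partial f^i/\partial\dot q^j$. The Jacobi endomorphism $\Phi$ is the $(1,1)$ tensor field along $\tau$ (for $p\in TM$ it gives $\Phi_p\in\mathrm{End}(T_{\tau(p)}M)$) with components $$\Phi^i_j=-\frac{\partial f^i}{\partial q^j}-\Gamma^k_j\Gamma^i_k-\Gamma(\Gamma^i_j),$$ and its dynamical covariant derivative $\nabla\Phi$, given by $(\nabla\Phi)(X)=\nabla(\Phi(X))-\Phi(\nabla X)$ with $\nabla\,\partial/\partial q^j=\Gamma^i_j\,\partial/\partial q^i$ and $\nabla(hX)=h\nabla X+\Gamma(h)X$, has components $\Gamma(\Phi^i_j)+\Gamma^i_k\Phi^k_j-\Phi^i_k\Gamma^k_j$. An eigenfunction of $\Phi$ on an open set $U\subseteq TM$ is a function $\lambda$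 that is smooth on $U$, such that $\lambda(p)$ is an eigenvalue of $\Phi_p$ for every $p\in U$ and $\lambda\,\mathrm{Id}-\Phi$ has constant rank on $U$. We say that $\Phi$ is diagonalizable on $U$ if for every $p\in U$ the endomorphism $\Phi_p$ is diagonalizable over $\mathbb R$ and each eigenvalue of $\Phi_p$ is the value at $p$ of an eigenfunction defined on a neighbourhood of $p$ in $U$. A Jacobi field along a base integral curve $c:\mathbb R\to M$ is a (differentiable) vector field $J$ along $c$ whose complete lift $J^{c}=J^i\,\partial/\partial q^i+\dot J^i\,\partial/\partial\dot q^i$ along $\dot c$ is, on every compact time interval $K$, the variation field $\frac{\partial\zeta}{\partial s}(0,t)$ of a family $\zeta:\,]-\varepsilon,\varepsilon[\,\times K\to TM$ of integral curves $\zeta(s,\cdot)$ of $\Gamma$ with $\zeta(0,\cdot)=\dot c|_K$. The point $c(t_1)$ is conjugate to $c(0)$ along $c$ if there is a Jacobi field $J\not\equiv0$ along $c$ with $J(0)=J(t_1)=0$. Let $G$ be a connected (finite-dimensional) Lie group acting smoothly, freely and properly on $M$ by $\psi:G\times M\to M$, and let $\Gamma$ be $G$-invariant: $TT\psi_g\circ\Gamma=\Gamma\circ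 T\psi_g$ for all $g\in G$. Assume that $[\nabla\Phi,\Phi]=0$ (commutator of endomorphisms) on $TM$. Let $\xi\in\mathfrak g$ and let $c:\mathbb R\to M$ be a relative equilibrium with generator $\xi$, i.e. a base integral curve of $\Gamma$ that is also an integral curve of the fundamental vector field $\xi_M(m)=\frac{d}{dt}\big|_{0}\exp(t\xi)m$; write $c(0)=m_0$, $\dot c(0)=v$. Suppose that $\Phi$ is diagonalizable on an open set $U\subseteq TM$ containing $(m_0,v)$ (for instance $U=TM$), and that $\lambda$ is an eigenfunction of $\Phi$ on $U$ which is strictly positive at $(m_0,v)$; write $\lambda_0=\lambda(m_0,v)$. Then for all $k\in\mathbb Z$ $$c\Big(\frac{k\pi}{\sqrt{\lambda_0}}\Big)=\exp\Big(\frac{k\pi}{\sqrt{\lambda_0}}\,\xi\Big)m_0,$$ and this point is conjugate to $m_0$ along $c$: there is a Jacobi field $J\not\equiv0$ along $c$ with $J(0)=0$ and $J\big(k\pi/\sqrt{\lambda_0}\big)=0$. -/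

import Mathlib

open scoped Manifold ContDiff

noncomputable section

namespace SODE

section Calculus

variable {E : Type*} [NormedAddCommGroup E] [NormedSpace ℝ E]
  {M : Type*} [TopologicalSpace M] [ChartedSpace E M] [IsManifold 𝓘(ℝ, E) ∞ M]

/-- A second-order differential equation field on `M`: a smooth vector field `Γ` on `TM` with
`Tτ (Γ p) = p` for every `p ∈ TM`, where `τ : TM → M`. In natural coordinates,
`Γ = q̇ ∂/∂q + f(q, q̇) ∂/∂q̇`; equivalently, the integral curves of `Γ` are lifted curves. -/
structure IsSODE
    (Γ : (p : TangentBundle 𝓘(ℝ, E) M) → TangentSpace 𝓘(ℝ, E).tangent p) : Prop where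
  smooth : ContMDiff 𝓘(ℝ, E).tangent 𝓘(ℝ, E).tangent.tangent ∞
    (fun p ↦ (⟨p, Γ p⟩ :
      TangentBundle 𝓘(ℝ, E).tangent (TangentBundle 𝓘(ℝ, E) M)))
  second_order : ∀ p : TangentBundle 𝓘(ℝ, E) M,
    mfderiv 𝓘(ℝ, E).tangent 𝓘(ℝ, E)
      (fun q : TangentBundle 𝓘(ℝ, E) M ↦ q.proj) p (Γ p) = p.2

/-- The coordinate expression `(q, q̇) ↦ (q̇, f(q, q̇))` of `Γ` in the natural chart of `TM`
induced by the preferred chart of `M` at the base point of `p`. -/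
def coordField (Γ : (p : TangentBundle 𝓘(ℝ, E) M) → TangentSpace 𝓘(ℝ, E).tangent p)
    (p : TangentBundle 𝓘(ℝ, E) M) (z : E × E) : E × E :=
  let y : TangentBundle 𝓘(ℝ, E) M := (extChartAt 𝓘(ℝ, E).tangent p).symm z
  tangentCoordChange 𝓘(ℝ, E).tangent y p y (Γ y)

/-- The force `f = (fⁱ)` of `Γ` in the natural chart at `p`. -/
def coordForce (Γ : (p : TangentBundle 𝓘(ℝ, E) M) → TangentSpace 𝓘(ℝ, E).tangent p)
    (p : TangentBundle 𝓘(ℝ, E) M) (z : E × E) : E :=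
  (coordField Γ p z).2

/-- The connection coefficients `Γⁱⱼ = -½ ∂fⁱ/∂q̇ʲ`, as the matrix `(Γⁱⱼ)`, in the natural chart
at `p`. -/
def coordConnection (Γ : (p : TangentBundle 𝓘(ℝ, E) M) → TangentSpace 𝓘(ℝ, E).tangent p)
    (p : TangentBundle 𝓘(ℝ, E) M) (z : E × E) : E →L[ℝ] E :=
  -((1 / 2 : ℝ) • (fderiv ℝ (coordForce Γ p) z).comp (ContinuousLinearMap.inr ℝ E E))

/-- The components `Φⁱⱼ = -∂fⁱ/∂qʲ - Γᵏⱼ Γⁱₖ - Γ(Γⁱⱼ)` of the Jacobi endomorphism in the natural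
chart at `p`. -/
def coordJacobi (Γ : (p : TangentBundle 𝓘(ℝ, E) M) → TangentSpace 𝓘(ℝ, E).tangent p)
    (p : TangentBundle 𝓘(ℝ, E) M) (z : E × E) : E →L[ℝ] E :=
  -((fderiv ℝ (coordForce Γ p) z).comp (ContinuousLinearMap.inl ℝ E E))
    - (coordConnection Γ p z).comp (coordConnection Γ p z)
    - fderiv ℝ (coordConnection Γ p) z (coordField Γ p z)

/-- The components `Γ(Φⁱⱼ) + Γⁱₖ Φᵏⱼ - Φⁱₖ Γᵏⱼ` of the dynamical covariant derivative `∇Φ`,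
where `(∇Φ)(X) = ∇(Φ(X)) - Φ(∇X)` and `∇(∂/∂qʲ) = Γⁱⱼ ∂/∂qⁱ`, `∇(hX) = h ∇X + Γ(h) X`. -/
def coordNablaJacobi (Γ : (p : TangentBundle 𝓘(ℝ, E) M) → TangentSpace 𝓘(ℝ, E).tangent p)
    (p : TangentBundle 𝓘(ℝ, E) M) (z : E × E) : E →L[ℝ] E :=
  fderiv ℝ (coordJacobi Γ p) z (coordField Γ p z)
    + (coordConnection Γ p z).comp (coordJacobi Γ p z)
    - (coordJacobi Γ p z).comp (coordConnection Γ p z)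

/-- The Jacobi endomorphism `Φ_p : T_mM → T_mM`, `m = τ(p)`, a (1,1) tensor field along `τ`.
The preferred chart at `m` identifies `T_mM` with `E`, so `Φ_p` is given by the components in that
chart. -/
def jacobiEndo (Γ : (p : TangentBundle 𝓘(ℝ, E) M) → TangentSpace 𝓘(ℝ, E).tangent p)
    (p : TangentBundle 𝓘(ℝ, E) M) : Module.End ℝ (TangentSpace 𝓘(ℝ, E) p.proj) :=
  (coordJacobi Γ p (extChartAt 𝓘(ℝ, E).tangent p p) : E →ₗ[ℝ] E)

/-- The dynamical covariant derivative `∇Φ` of the Jacobi endomorphism, at `p ∈ TM`. -/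
def nablaJacobiEndo (Γ : (p : TangentBundle 𝓘(ℝ, E) M) → TangentSpace 𝓘(ℝ, E).tangent p)
    (p : TangentBundle 𝓘(ℝ, E) M) : Module.End ℝ (TangentSpace 𝓘(ℝ, E) p.proj) :=
  (coordNablaJacobi Γ p (extChartAt 𝓘(ℝ, E).tangent p p) : E →ₗ[ℝ] E)

/-- `lam` is an eigenfunction of `Φ` on the open set `U ⊆ TM`: it is smooth on `U`, `lam p` is an
eigenvalue of `Φ_p` for `p ∈ U`, and `lam Id - Φ` has constant rank on `U`. -/
structure IsEigenfunctionOn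
    (Γ : (p : TangentBundle 𝓘(ℝ, E) M) → TangentSpace 𝓘(ℝ, E).tangent p)
    (U : Set (TangentBundle 𝓘(ℝ, E) M)) (lam : TangentBundle 𝓘(ℝ, E) M → ℝ) : Prop where
  isOpen : IsOpen U
  smooth : ContMDiffOn 𝓘(ℝ, E).tangent 𝓘(ℝ, ℝ) ∞ lam U
  eigenvalue : ∀ p ∈ U, (jacobiEndo Γ p).HasEigenvalue (lam p)
  constant_rank : ∃ r : ℕ, ∀ p ∈ U,
    Module.finrank ℝ (LinearMap.range (lam p • LinearMap.id - jacobiEndo Γ p)) = r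

/-- `Φ` is diagonalizable on `U ⊆ TM`: every `Φ_p`, `p ∈ U`, is diagonalizable over `ℝ` (the
eigenspaces span), and every eigenvalue of every `Φ_p` is the value at `p` of an eigenfunction
defined on a neighbourhood of `p`. -/
structure IsDiagonalizableOn
    (Γ : (p : TangentBundle 𝓘(ℝ, E) M) → TangentSpace 𝓘(ℝ, E).tangent p)
    (U : Set (TangentBundle 𝓘(ℝ, E) M)) : Prop where
  pointwise : ∀ p ∈ U, ⨆ a : ℝ, (jacobiEndo Γ p).eigenspace a = ⊤
  locally_smooth : ∀ p ∈ U, ∀ a : ℝ, (jacobiEndo Γ p).HasEigenvalue a →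
    ∃ (V : Set (TangentBundle 𝓘(ℝ, E) M)) (mu : TangentBundle 𝓘(ℝ, E) M → ℝ),
      p ∈ V ∧ V ⊆ U ∧ IsEigenfunctionOn Γ V mu ∧ mu p = a

/-- The lifted curve `ċ(t) ∈ T_{c(t)}M` of a curve `c` in `M`. -/
def velocity (c : ℝ → M) (t : ℝ) : TangentBundle 𝓘(ℝ, E) M :=
  ⟨c t, mfderiv 𝓘(ℝ, ℝ) 𝓘(ℝ, E) c t (1 : ℝ)⟩

/-- `c` is a base integral curve of `Γ`: its lift `ċ` is an integral curve of `Γ`. -/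
def IsBaseIntegralCurve
    (Γ : (p : TangentBundle 𝓘(ℝ, E) M) → TangentSpace 𝓘(ℝ, E).tangent p) (c : ℝ → M) : Prop :=
  IsMIntegralCurve (I := 𝓘(ℝ, E).tangent) (velocity (E := E) c) Γ

/-- The complete lift `Wⁱ ∂/∂qⁱ + (dWⁱ/dt) ∂/∂q̇ⁱ`, along `ċ`, of a vector field `W` along `c`.
The component functions `Wⁱ` near time `t` are taken in the preferred chart at `c t`, whose natural
chart also identifies `T_{ċ(t)}TM` with `E × E`. -/
def completeLift (c : ℝ → M) (W : (t : ℝ) → TangentSpace 𝓘(ℝ, E) (c t)) (t : ℝ) :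
    TangentSpace 𝓘(ℝ, E).tangent (velocity (E := E) c t) :=
  ((W t, deriv (fun s ↦ tangentCoordChange 𝓘(ℝ, E) (c s) (c t) (c s) (W s)) t) : E × E)

end Calculus

section Variation

variable {F : Type*} [NormedAddCommGroup F] [NormedSpace ℝ F] {H : Type*} [TopologicalSpace H]
  {I : ModelWithCorners ℝ F H} {N : Type*} [TopologicalSpace N] [ChartedSpace H N]

/-- On the time interval `K`, the vector field `Z` along the curve `z` is the variation vector
field `Z(t) = ∂ζ/∂s (0, t)` of a 1-parameter family `ζ : ]-ε, ε[ × K → N` of integral curves of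
the vector field `Y`, with `ζ(0, ·) = z`. -/
def IsVariationFieldOn [IsManifold I 1 N] (Y : (x : N) → TangentSpace I x) (z : ℝ → N)
    (Z : (t : ℝ) → TangentSpace I (z t)) (K : Set ℝ) : Prop :=
  ∃ ε > 0, ∃ ζ : ℝ → ℝ → N,
    (∀ s ∈ Set.Ioo (-ε) ε, IsMIntegralCurveOn (ζ s) Y K) ∧
    ∀ t ∈ K, MDifferentiableAt 𝓘(ℝ, ℝ) I (fun s ↦ ζ s t) 0 ∧
      (⟨ζ 0 t, mfderiv 𝓘(ℝ, ℝ) I (fun s ↦ ζ s t) 0 (1 : ℝ)⟩ : TangentBundle I N) = ⟨z t, Z t⟩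

end Variation

section Jacobi

variable {E : Type*} [NormedAddCommGroup E] [NormedSpace ℝ E]
  {M : Type*} [TopologicalSpace M] [ChartedSpace E M] [IsManifold 𝓘(ℝ, E) ∞ M]

/-- `J` is a Jacobi field along the base integral curve `c` of `Γ`: a (differentiable) vector field
along `c` whose complete lift is, on every compact time interval, a variation vector field along
`ċ` by integral curves of `Γ`. -/
structure IsJacobiField
    (Γ : (p : TangentBundle 𝓘(ℝ, E) M) → TangentSpace 𝓘(ℝ, E).tangent p)
    (c : ℝ → M) (J : (t : ℝ) → TangentSpace 𝓘(ℝ, E) (c t)) : Prop where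
  differentiable : MDifferentiable 𝓘(ℝ, ℝ) 𝓘(ℝ, E).tangent
    (fun t ↦ (⟨c t, J t⟩ : TangentBundle 𝓘(ℝ, E) M))
  variation : ∀ a b : ℝ, a < b →
    IsVariationFieldOn Γ (velocity (E := E) c) (completeLift c J) (Set.Icc a b)

/-- The point `c t₁` is conjugate to `c 0` along `c`: there is a Jacobi field along `c`, not
identically zero, that vanishes at the times `0` and `t₁`. -/
def IsConjugateAt
    (Γ : (p : TangentBundle 𝓘(ℝ, E) M) → TangentSpace 𝓘(ℝ, E).tangent p)
    (c : ℝ → M) (t₁ : ℝ) : Prop :=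
  ∃ J : (t : ℝ) → TangentSpace 𝓘(ℝ, E) (c t),
    IsJacobiField Γ c J ∧ (∃ t, J t ≠ 0) ∧ J 0 = 0 ∧ J t₁ = 0

end Jacobi

section Symmetry

variable {F : Type*} [NormedAddCommGroup F] [NormedSpace ℝ F]
  {G : Type*} [TopologicalSpace G] [ChartedSpace F G] [Group G]
  {E : Type*} [NormedAddCommGroup E] [NormedSpace ℝ E]
  {M : Type*} [TopologicalSpace M] [ChartedSpace E M] [IsManifold 𝓘(ℝ, E) ∞ M] [MulAction G M]

open Classical in
/-- The exponential map of a Lie group `G`: `exp ξ = γ(1)`, where `γ` is the integral curve of the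
left-invariant vector field of `ξ ∈ 𝔤 = T_1G` with `γ(0) = 1` (these fields are complete). -/
def lieExp (ξ : GroupLieAlgebra 𝓘(ℝ, F) G) : G :=
  if h : ∃ γ : ℝ → G, γ 0 = 1 ∧ IsMIntegralCurve γ (mulInvariantVectorField ξ) then
    h.choose 1
  else 1

/-- The fundamental vector field `ξ_M(m) = d/dt|₀ exp(tξ) m = T_1(g ↦ g m)(ξ)` on `M`. -/
def fundamentalField (ξ : GroupLieAlgebra 𝓘(ℝ, F) G) (m : M) : TangentSpace 𝓘(ℝ, E) m :=
  (mfderiv 𝓘(ℝ, F) 𝓘(ℝ, E) (fun g : G ↦ g • m) 1 ξ : E)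

/-- `Γ` is invariant under the action `ψ` of `G`: `TTψ_g ∘ Γ = Γ ∘ Tψ_g` for all `g ∈ G`. -/
def IsInvariant (G : Type*) [Group G] [MulAction G M]
    (Γ : (p : TangentBundle 𝓘(ℝ, E) M) → TangentSpace 𝓘(ℝ, E).tangent p) : Prop :=
  ∀ (g : G) (p : TangentBundle 𝓘(ℝ, E) M),
    mfderiv 𝓘(ℝ, E).tangent 𝓘(ℝ, E).tangent
      (tangentMap 𝓘(ℝ, E) 𝓘(ℝ, E) (fun m : M ↦ g • m)) p (Γ p) =
    Γ (tangentMap 𝓘(ℝ, E) 𝓘(ℝ, E) (fun m : M ↦ g • m) p)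

/-- The base integral curve `c` of `Γ` is a relative equilibrium with generator `ξ`: it coincides
with an integral curve of the fundamental vector field `ξ_M`. -/
structure IsRelativeEquilibrium
    (Γ : (p : TangentBundle 𝓘(ℝ, E) M) → TangentSpace 𝓘(ℝ, E).tangent p)
    (ξ : GroupLieAlgebra 𝓘(ℝ, F) G) (c : ℝ → M) : Prop where
  base : IsBaseIntegralCurve Γ c
  group_orbit : IsMIntegralCurve (I := 𝓘(ℝ, E)) c (fundamentalField ξ)

end Symmetry

end SODE

end

/-!
Along a relative equilibrium `c t = exp (t ξ) m₀` the time dependence of the Jacobi equation can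
be removed by the symmetry. Let `ψ t m = exp (t ξ) m`, with generator `η = ξ_M`; its tangent lift
`Tψ` preserves `Γ` and has the complete lift `η^c` as its generator. The orbit of `p₀ = (m₀, v)`
under `Tψ` is the integral curve `ċ` of `Γ`, so `p₀` is a zero of `Γ - η^c`, and `Tψ` carries the
integral curves of `Γ - η^c` near `p₀` to integral curves of `Γ` near `ċ`
(`IsSmoothFlow.isMIntegralCurveOn_of_hasDerivWithinAt`). Jacobi fields along `c` therefore
correspond to solutions of the linearization of `Γ - η^c` at `p₀`, a linear equation with constant
coefficients (`exists_variation_of_zero`, `IsSmoothFlow.isVariationFieldOn`).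

In the natural chart at `p₀`, let `C` be the matrix of connection coefficients at `p₀` and
`N = η' + C`, the matrix of the dynamical covariant derivative in a frame that is invariant under
`ψ`. As the Lie derivative of `Φ` along `η` vanishes, `∇Φ = [N, Φ]` at `p₀`
(`IsInfinitesimalSymmetryAt.nabla_jacobiCoeff`). If `Φ` is diagonalizable and commutes with
`[N, Φ]`, then it commutes with `N` (`mul_comm_of_commutator_commute`): on an eigenspace of `Φ`,
`[N, Φ]` takes values in that eigenspace and in the sum of the others. Hence `exp (-t N)`
preserves the eigenspace of `Φ` for the eigenvalue `λ₀ = ν ^ 2`. For an eigenvector `w` and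
`e t = exp (-t N) w`, the field `x t = sin (ν t) e t` solves the linearized equation
(`IsInfinitesimalSymmetryAt.hasDerivAt_linearized_solution`), and `J t = Tψ_t (x t)` is a Jacobi
field along `c` that vanishes exactly at the multiples of `π / ν`.
-/

open scoped Manifold ContDiff Topology NNReal
open Filter Set

noncomputable section

namespace SODE

/-! ### Commutation of diagonalizable endomorphisms -/

section LinearAlgebra

/-- If `Φ` is diagonalizable and commutes with `[N, Φ]`, then `N` commutes with `Φ`: on an
eigenspace, `[N, Φ]` takes values in the intersection of the kernel and the range of `Φ - a`. -/
theorem mul_comm_of_commutator_commute {K V : Type*} [Field K] [AddCommGroup V] [Module K V]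
    {N Φ : Module.End K V} (hd : ⨆ a : K, Φ.eigenspace a = ⊤)
    (h : (N * Φ - Φ * N) * Φ = Φ * (N * Φ - Φ * N)) : N * Φ = Φ * N := by
  rw [← sub_eq_zero, ← LinearMap.ker_eq_top, eq_top_iff, ← hd]
  refine iSup_le fun a w hw ↦ ?_
  have hw' : Φ w = a • w := Module.End.mem_eigenspace_iff.1 hw
  set S : Submodule K V := ⨆ b ≠ a, Φ.eigenspace b with hS
  have hdis : Disjoint (Φ.eigenspace a) S := Module.End.eigenspaces_iSupIndep Φ a
  have hsup : Φ.eigenspace a ⊔ S = ⊤ := by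
    rw [← hd]
    refine le_antisymm (sup_le (le_iSup _ a) (iSup₂_le fun b _ ↦ le_iSup _ b)) (iSup_le fun b ↦ ?_)
    by_cases hb : b = a
    · subst hb; exact le_sup_left
    · exact le_sup_of_le_right (le_iSup₂_of_le b hb le_rfl)
  obtain ⟨x, hx, y, hy, hxy⟩ := Submodule.mem_sup.1 (hsup ▸ Submodule.mem_top : N w ∈ _)
  have hx' : Φ x = a • x := Module.End.mem_eigenspace_iff.1 hx
  have hinv : S ≤ S.comap Φ := by
    refine iSup₂_le fun b hb z hz ↦ ?_
    rw [Submodule.mem_comap, Module.End.mem_eigenspace_iff.1 hz]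
    exact S.smul_mem _ ((le_iSup₂_of_le b hb le_rfl : Φ.eigenspace b ≤ S) hz)
  have hD : (N * Φ - Φ * N) w = a • y - Φ y := by
    simp only [LinearMap.sub_apply, Module.End.mul_apply, hw', map_smul, ← hxy, map_add, hx',
      smul_add]
    abel
  have h1 : (N * Φ - Φ * N) w ∈ S := hD ▸ S.sub_mem (S.smul_mem _ hy) (hinv hy)
  have h2 : (N * Φ - Φ * N) w ∈ Φ.eigenspace a := by
    rw [Module.End.mem_eigenspace_iff]
    have := LinearMap.congr_fun h w
    simp only [Module.End.mul_apply, hw', map_smul] at this ⊢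
    exact this.symm
  exact LinearMap.mem_ker.2 (Submodule.disjoint_def.1 hdis _ h2 h1)

end LinearAlgebra

/-! ### Infinitesimal symmetries of second-order fields in coordinates -/

section CoordinateCalculus

variable {E : Type*} [NormedAddCommGroup E] [NormedSpace ℝ E]

/-- The connection coefficients of the second-order field `S = (q̇, f)` on `E × E`. -/
def connCoeff (S : E × E → E × E) (z : E × E) : E →L[ℝ] E :=
  -((1 / 2 : ℝ) • (fderiv ℝ (fun z ↦ (S z).2) z).comp (ContinuousLinearMap.inr ℝ E E))

/-- The Jacobi endomorphism of the second-order field `S = (q̇, f)` on `E × E`. -/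
def jacobiCoeff (S : E × E → E × E) (z : E × E) : E →L[ℝ] E :=
  -((fderiv ℝ (fun z ↦ (S z).2) z).comp (ContinuousLinearMap.inl ℝ E E))
    - (connCoeff S z).comp (connCoeff S z) - fderiv ℝ (connCoeff S) z (S z)

/-- The complete lift `(η, η' q̇)` to `E × E` of the vector field `η` on `E`. -/
def liftField (η : E → E) (z : E × E) : E × E :=
  (η z.1, fderiv ℝ η z.1 z.2)

variable {S : E × E → E × E} {η : E → E} {z : E × E}

/-- `η` is an infinitesimal symmetry of the second-order field `S`, at and around `z`. -/
structure IsInfinitesimalSymmetryAt (S : E × E → E × E) (η : E → E) (z : E × E) : Prop where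
  smooth_field : ContDiffAt ℝ 5 S z
  smooth_symm : ContDiffAt ℝ 5 η z.1
  fst_eq : ∀ᶠ y in 𝓝 z, (S y).1 = y.2
  bracket_eq : ∀ᶠ y in 𝓝 z, fderiv ℝ S y (liftField η y) = fderiv ℝ (liftField η) y (S y)

theorem IsInfinitesimalSymmetryAt.eventually (h : IsInfinitesimalSymmetryAt S η z) :
    ∀ᶠ y in 𝓝 z, IsInfinitesimalSymmetryAt S η y := by
  filter_upwards [h.smooth_field.eventually (by simp),
    continuousAt_fst.eventually (h.smooth_symm.eventually (by simp)),
    h.fst_eq.eventually_nhds, h.bracket_eq.eventually_nhds] with y h1 h2 h3 h4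
  exact ⟨h1, h2, h3, h4⟩

theorem hasFDerivAt_fderiv_comp_fst {F : Type*} [NormedAddCommGroup F] [NormedSpace ℝ F]
    {g : E → F} (hg : ContDiffAt ℝ 2 g z.1) :
    HasFDerivAt (fun y : E × E ↦ fderiv ℝ g y.1)
      ((fderiv ℝ (fderiv ℝ g) z.1).comp (ContinuousLinearMap.fst ℝ E E)) z :=
  ((hg.fderiv_right (m := 1) (by norm_num)).differentiableAt (by norm_num)).hasFDerivAt.comp z
    hasFDerivAt_fst

theorem hasFDerivAt_liftField (hη : ContDiffAt ℝ 2 η z.1) :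
    HasFDerivAt (liftField η)
      (((fderiv ℝ η z.1).comp (ContinuousLinearMap.fst ℝ E E)).prod
        ((fderiv ℝ η z.1).comp (ContinuousLinearMap.snd ℝ E E) +
          ((fderiv ℝ (fderiv ℝ η) z.1).comp (ContinuousLinearMap.fst ℝ E E)).flip z.2)) z :=
  ((hη.differentiableAt (by norm_num)).hasFDerivAt.comp z hasFDerivAt_fst).prodMk
    ((hasFDerivAt_fderiv_comp_fst hη).clm_apply hasFDerivAt_snd)

theorem fderiv_liftField_apply (hη : ContDiffAt ℝ 2 η z.1) (h : E × E) :
    fderiv ℝ (liftField η) z h =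
      (fderiv ℝ η z.1 h.1, fderiv ℝ η z.1 h.2 + fderiv ℝ (fderiv ℝ η) z.1 h.1 z.2) := by
  rw [(hasFDerivAt_liftField hη).fderiv]; rfl

theorem contDiffAt_liftField (hη : ContDiffAt ℝ 5 η z.1) : ContDiffAt ℝ 4 (liftField η) z := by
  have h1 : ContDiffAt ℝ 4 (fun y : E × E ↦ η y.1) z :=
    (hη.of_le (by norm_num)).comp z contDiffAt_fst
  have h2 : ContDiffAt ℝ 4 (fun y : E × E ↦ fderiv ℝ η y.1) z :=
    (hη.fderiv_right (m := 4) (by norm_num)).comp z contDiffAt_fst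
  exact h1.prodMk (h2.clm_apply contDiffAt_snd)

namespace IsInfinitesimalSymmetryAt

variable (h : IsInfinitesimalSymmetryAt S η z)
include h

theorem force_eventually : ∀ᶠ y in 𝓝 z, fderiv ℝ (fun z ↦ (S z).2) y (liftField η y) =
    fderiv ℝ (fderiv ℝ η) y.1 y.2 y.2 + fderiv ℝ η y.1 (S y).2 := by
  filter_upwards [h.eventually] with y hy
  have h1 := hy.bracket_eq.self_of_nhds
  rw [fderiv_liftField_apply (hy.smooth_symm.of_le (by norm_num)), hy.fst_eq.self_of_nhds] at h1
  have h2 : HasFDerivAt (fun z ↦ (S z).2) ((ContinuousLinearMap.snd ℝ E E).comp (fderiv ℝ S y)) y :=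
    (hy.smooth_field.differentiableAt (by norm_num)).hasFDerivAt.snd
  rw [h2.fderiv, ContinuousLinearMap.comp_apply, h1]
  simp [add_comm]

theorem contDiffAt_force : ContDiffAt ℝ 5 (fun z ↦ (S z).2) z := h.smooth_field.snd

/-- The derivative of the invariance equation of the force in the direction `k`. -/
theorem fderiv_force (k : E × E) :
    fderiv ℝ (fderiv ℝ fun z ↦ (S z).2) z k (liftField η z)
      + fderiv ℝ (fun z ↦ (S z).2) z (fderiv ℝ (liftField η) z k) =
    fderiv ℝ (fderiv ℝ (fderiv ℝ η)) z.1 k.1 z.2 z.2 + fderiv ℝ (fderiv ℝ η) z.1 k.2 z.2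
      + fderiv ℝ (fderiv ℝ η) z.1 z.2 k.2 + fderiv ℝ (fderiv ℝ η) z.1 k.1 (S z).2
      + fderiv ℝ η z.1 (fderiv ℝ (fun z ↦ (S z).2) z k) := by
  have hη := h.smooth_symm
  have hf := h.contDiffAt_force
  have h1 := ((hf.fderiv_right (m := 1) (by norm_num)).differentiableAt
    (by norm_num)).hasFDerivAt.clm_apply
    ((contDiffAt_liftField hη).differentiableAt (by norm_num)).hasFDerivAt
  have hη2 : ContDiffAt ℝ 2 (fderiv ℝ η) z.1 := hη.fderiv_right (by norm_num)
  have h2 := (((hasFDerivAt_fderiv_comp_fst hη2).clm_apply hasFDerivAt_snd).clm_apply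
    hasFDerivAt_snd).add ((hasFDerivAt_fderiv_comp_fst (hη.of_le (by norm_num))).clm_apply
      (hf.differentiableAt (by norm_num)).hasFDerivAt)
  have h3 := (h1.congr_of_eventuallyEq (EventuallyEq.symm h.force_eventually)).unique h2
  have h4 := DFunLike.congr_fun h3 k
  simp only [add_apply, ContinuousLinearMap.comp_apply,
    ContinuousLinearMap.flip_apply, ContinuousLinearMap.coe_fst',
    ContinuousLinearMap.coe_snd'] at h4
  rw [add_comm, h4]
  abel

/-- The connection coefficients transform under the symmetry as those of a connection. -/
theorem fderiv_connCoeff :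
    fderiv ℝ (connCoeff S) z (liftField η z) =
      (fderiv ℝ η z.1).comp (connCoeff S z) - (connCoeff S z).comp (fderiv ℝ η z.1)
        - fderiv ℝ (fderiv ℝ η) z.1 z.2 := by
  have hη := h.smooth_symm
  have hf := h.contDiffAt_force
  have hC : HasFDerivAt (connCoeff S) _ z :=
    ((((hf.fderiv_right (m := 1) (by norm_num)).differentiableAt
    (by norm_num)).hasFDerivAt.clm_comp (hasFDerivAt_const (ContinuousLinearMap.inr ℝ E E) z)
    ).const_smul (1 / 2 : ℝ)).neg
  rw [hC.fderiv]
  ext w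
  have h1 := h.fderiv_force (0, w)
  have hs := (hf.isSymmSndFDerivAt (by simp; norm_num)).eq (liftField η z) (0, w)
  have hs2 := ((hη.isSymmSndFDerivAt (by simp; norm_num)).eq w z.2)
  rw [fderiv_liftField_apply (hη.of_le (by norm_num))] at h1
  simp only [map_zero, zero_apply, zero_add, add_zero] at h1
  simp only [connCoeff, neg_apply, smul_apply,
    add_apply, ContinuousLinearMap.comp_apply, sub_apply,
    ContinuousLinearMap.compL_apply, ContinuousLinearMap.flip_apply,
    zero_apply, ContinuousLinearMap.inr_apply, map_neg, map_smul, hs]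
  rw [hs2] at h1
  rw [eq_sub_of_add_eq h1]
  simp
  module

/-- The third derivative of `η` is symmetric in the two pairs of arguments swapped here. -/
theorem third_fderiv_symm (x : E) :
    fderiv ℝ (fderiv ℝ (fderiv ℝ η)) z.1 x z.2 z.2 =
      fderiv ℝ (fderiv ℝ (fderiv ℝ η)) z.1 z.2 z.2 x := by
  have hη := h.smooth_symm
  have hη1 : ContDiffAt ℝ 2 (fderiv ℝ η) z.1 := hη.fderiv_right (by norm_num)
  have hη2 : DifferentiableAt ℝ (fderiv ℝ (fderiv ℝ η)) z.1 :=
    (hη1.fderiv_right (m := 1) (by norm_num)).differentiableAt (by norm_num)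
  rw [(hη1.isSymmSndFDerivAt (by simp)).eq x z.2]
  have h1 : ∀ a b : E, HasFDerivAt (fun q ↦ fderiv ℝ (fderiv ℝ η) q a b)
      ((((fderiv ℝ (fderiv ℝ (fderiv ℝ η)) z.1).flip a)).flip b) z.1 := fun a b ↦ by
    convert (hη2.hasFDerivAt.clm_apply (hasFDerivAt_const a z.1)).clm_apply
      (hasFDerivAt_const b z.1) using 1
    ext; simp
  have h2 : (fun q ↦ fderiv ℝ (fderiv ℝ η) q x z.2) =ᶠ[𝓝 z.1]
      fun q ↦ fderiv ℝ (fderiv ℝ η) q z.2 x := by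
    filter_upwards [hη.eventually (by simp)] with q hq
    exact (hq.isSymmSndFDerivAt (by simp; norm_num)).eq x z.2
  exact DFunLike.congr_fun
    ((h1 x z.2).unique ((h1 z.2 x).congr_of_eventuallyEq h2)) z.2

/-- The Lie derivative of `∂f/∂q` along an infinitesimal symmetry: the derivative in `q` of the
symmetry condition on `f`. -/
theorem fderiv_force_comp_inl :
    fderiv ℝ (fun y ↦ (fderiv ℝ (fun z ↦ (S z).2) y).comp (ContinuousLinearMap.inl ℝ E E)) z
        (liftField η z) =
      (fderiv ℝ η z.1).comp ((fderiv ℝ (fun z ↦ (S z).2) z).comp (ContinuousLinearMap.inl ℝ E E))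
        - ((fderiv ℝ (fun z ↦ (S z).2) z).comp (ContinuousLinearMap.inl ℝ E E)).comp
          (fderiv ℝ η z.1)
        + (2 : ℝ) • (connCoeff S z).comp (fderiv ℝ (fderiv ℝ η) z.1 z.2)
        + fderiv ℝ (fderiv ℝ (fderiv ℝ η)) z.1 z.2 z.2
        + fderiv ℝ (fderiv ℝ η) z.1 (S z).2 := by
  have hη := h.smooth_symm
  have hf := h.contDiffAt_force
  have hK := ((hf.fderiv_right (m := 1) (by norm_num)).differentiableAt
    (by norm_num)).hasFDerivAt.clm_comp (hasFDerivAt_const (ContinuousLinearMap.inl ℝ E E) z)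
  rw [hK.fderiv]
  ext x
  have h1 := h.fderiv_force (x, 0)
  have hs := (hf.isSymmSndFDerivAt (by simp; norm_num)).eq (liftField η z) (x, 0)
  have hs2 := fun y ↦ ((hη.isSymmSndFDerivAt (by simp; norm_num)).eq x y)
  rw [fderiv_liftField_apply (hη.of_le (by norm_num)), h.third_fderiv_symm x] at h1
  have hsplit : ∀ a b : E, fderiv ℝ (fun z ↦ (S z).2) z (a, b) =
      fderiv ℝ (fun z ↦ (S z).2) z (a, 0) + fderiv ℝ (fun z ↦ (S z).2) z (0, b) := fun a b ↦ by
    rw [← map_add]; simp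
  simp only [map_zero, zero_apply, zero_add, add_zero, hs2] at h1
  rw [hsplit] at h1
  simp only [connCoeff, neg_apply, smul_apply,
    add_apply, ContinuousLinearMap.comp_apply, sub_apply,
    ContinuousLinearMap.compL_apply, ContinuousLinearMap.flip_apply,
    zero_apply, ContinuousLinearMap.inr_apply, ContinuousLinearMap.inl_apply, hs]
  rw [eq_sub_of_add_eq h1]
  simp
  module

theorem contDiffAt_connCoeff : ContDiffAt ℝ 4 (connCoeff S) z :=
  (((h.contDiffAt_force.fderiv_right (m := 4) (by norm_num)).clm_comp
    contDiffAt_const).const_smul (1 / 2 : ℝ)).neg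

/-- The Lie derivative of `S(Γⁱⱼ)` along an infinitesimal symmetry: as the symmetry commutes with
`S`, it is the derivative along `S` of the Lie derivative of `Γⁱⱼ`. -/
theorem fderiv_fderiv_connCoeff :
    fderiv ℝ (fun y ↦ fderiv ℝ (connCoeff S) y (S y)) z (liftField η z) =
      (fderiv ℝ (fderiv ℝ η) z.1 z.2).comp (connCoeff S z)
        + (fderiv ℝ η z.1).comp (fderiv ℝ (connCoeff S) z (S z))
        - (fderiv ℝ (connCoeff S) z (S z)).comp (fderiv ℝ η z.1)
        - (connCoeff S z).comp (fderiv ℝ (fderiv ℝ η) z.1 z.2)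
        - fderiv ℝ (fderiv ℝ (fderiv ℝ η)) z.1 z.2 z.2
        - fderiv ℝ (fderiv ℝ η) z.1 (S z).2 := by
  have hη := h.smooth_symm
  have hC := h.contDiffAt_connCoeff
  have hC0 := (hC.differentiableAt (by norm_num)).hasFDerivAt
  have hC1 := ((hC.fderiv_right (m := 1) (by norm_num)).differentiableAt
    (by norm_num)).hasFDerivAt
  have hS := (h.smooth_field.differentiableAt (by norm_num)).hasFDerivAt
  have hX := ((contDiffAt_liftField hη).differentiableAt (by norm_num)).hasFDerivAt
  have hη1 := hasFDerivAt_fderiv_comp_fst (z := z) (hη.of_le (by norm_num))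
  have hη2 := hasFDerivAt_fderiv_comp_fst (z := z) (hη.fderiv_right (m := 2) (by norm_num))
  have e : (fun y ↦ fderiv ℝ (connCoeff S) y (liftField η y)) =ᶠ[𝓝 z] fun y ↦
      (fderiv ℝ η y.1).comp (connCoeff S y) - (connCoeff S y).comp (fderiv ℝ η y.1)
        - fderiv ℝ (fderiv ℝ η) y.1 y.2 := by
    filter_upwards [h.eventually] with y hy using hy.fderiv_connCoeff
  have h1 := ((hC1.clm_apply hX).congr_of_eventuallyEq e.symm).unique
    (((hη1.clm_comp hC0).sub (hC0.clm_comp hη1)).sub (hη2.clm_apply hasFDerivAt_snd))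
  have h2 := DFunLike.congr_fun h1 (S z)
  rw [(hC1.clm_apply hS).fderiv]
  have hs := (hC.isSymmSndFDerivAt (by simp; norm_num)).eq (liftField η z) (S z)
  simp only [add_apply, ContinuousLinearMap.comp_apply, ContinuousLinearMap.flip_apply, hs,
    h.bracket_eq.self_of_nhds] at h2 ⊢
  rw [h2]
  simp only [sub_apply, add_apply, ContinuousLinearMap.comp_apply, ContinuousLinearMap.flip_apply,
    ContinuousLinearMap.compL_apply, ContinuousLinearMap.coe_fst', ContinuousLinearMap.coe_snd',
    h.fst_eq.self_of_nhds]
  abel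

/-- The Lie derivative of the Jacobi endomorphism along an infinitesimal symmetry vanishes. -/
theorem fderiv_jacobiCoeff :
    fderiv ℝ (jacobiCoeff S) z (liftField η z) =
      (fderiv ℝ η z.1).comp (jacobiCoeff S z) - (jacobiCoeff S z).comp (fderiv ℝ η z.1) := by
  have hf := h.contDiffAt_force
  have hC := h.contDiffAt_connCoeff
  have hK : DifferentiableAt ℝ
      (fun y ↦ (fderiv ℝ (fun z ↦ (S z).2) y).comp (ContinuousLinearMap.inl ℝ E E)) z :=
    ((hf.fderiv_right (m := 1) (by norm_num)).differentiableAt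
      (by norm_num)).clm_comp (differentiableAt_const _)
  have hC0 := hC.differentiableAt (by norm_num)
  have hP : DifferentiableAt ℝ (fun y ↦ fderiv ℝ (connCoeff S) y (S y)) z :=
    ((hC.fderiv_right (m := 1) (by norm_num)).differentiableAt (by norm_num)).clm_apply
      (h.smooth_field.differentiableAt (by norm_num))
  have h1 : HasFDerivAt (jacobiCoeff S) _ z :=
    (hK.hasFDerivAt.neg.sub (hC0.hasFDerivAt.clm_comp hC0.hasFDerivAt)).sub hP.hasFDerivAt
  rw [h1.fderiv]
  simp only [sub_apply, neg_apply, add_apply, ContinuousLinearMap.comp_apply,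
    ContinuousLinearMap.compL_apply, ContinuousLinearMap.flip_apply, h.fderiv_force_comp_inl,
    h.fderiv_connCoeff, h.fderiv_fderiv_connCoeff]
  ext x
  simp only [jacobiCoeff, sub_apply, neg_apply, add_apply, smul_apply,
    ContinuousLinearMap.comp_apply, map_sub, map_neg]
  module

/-- At a zero of `S - η^c`, where `η^c` is the complete lift of `η`, the dynamical covariant
derivative of the Jacobi endomorphism is its commutator with `η' + Γ`, the matrix of the dynamical
covariant derivative in a frame invariant under the symmetry. -/
theorem nabla_jacobiCoeff (h0 : liftField η z = S z) :
    fderiv ℝ (jacobiCoeff S) z (S z) + (connCoeff S z).comp (jacobiCoeff S z)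
        - (jacobiCoeff S z).comp (connCoeff S z) =
      (fderiv ℝ η z.1 + connCoeff S z).comp (jacobiCoeff S z)
        - (jacobiCoeff S z).comp (fderiv ℝ η z.1 + connCoeff S z) := by
  rw [← h0, h.fderiv_jacobiCoeff, ContinuousLinearMap.add_comp, ContinuousLinearMap.comp_add]
  abel

/-- At a zero of `S - η^c`, the linearization of `S - η^c` in terms of the Jacobi endomorphism. -/
theorem fderiv_sub_liftField (h0 : liftField η z = S z) (k : E × E) :
    fderiv ℝ (fun y ↦ S y - liftField η y) z k =
      (k.2 - fderiv ℝ η z.1 k.1,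
        -jacobiCoeff S z k.1 - connCoeff S z (connCoeff S z k.1)
          - fderiv ℝ η z.1 (connCoeff S z k.1) + connCoeff S z (fderiv ℝ η z.1 k.1)
          - (2 : ℝ) • connCoeff S z k.2 - fderiv ℝ η z.1 k.2) := by
  have hη := h.smooth_symm
  have hS := (h.smooth_field.differentiableAt (by norm_num)).hasFDerivAt
  have hX := ((contDiffAt_liftField hη).differentiableAt (by norm_num)).hasFDerivAt
  have e1 : (fderiv ℝ S z k).1 = k.2 := by
    have h1 : HasFDerivAt (fun y ↦ (S y).1) _ z := hS.fst
    exact DFunLike.congr_fun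
      (h1.unique (hasFDerivAt_snd.congr_of_eventuallyEq h.fst_eq)) k
  have e2 : (fderiv ℝ S z k).2 = fderiv ℝ (fun z ↦ (S z).2) z (k.1, 0)
      - (2 : ℝ) • connCoeff S z k.2 := by
    have h1 : HasFDerivAt (fun y ↦ (S y).2) _ z := hS.snd
    have h2 : fderiv ℝ (fun z ↦ (S z).2) z k = fderiv ℝ (fun z ↦ (S z).2) z (k.1, 0)
        + fderiv ℝ (fun z ↦ (S z).2) z (0, k.2) := by
      rw [← map_add]; simp
    have h3 : fderiv ℝ (fun z ↦ (S z).2) z k = (fderiv ℝ S z k).2 := by rw [h1.fderiv]; rfl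
    rw [← h3, h2]
    simp only [connCoeff, neg_apply, smul_apply, ContinuousLinearMap.comp_apply,
      ContinuousLinearMap.inr_apply]
    module
  rw [(hS.fun_sub hX).fderiv, sub_apply, fderiv_liftField_apply (hη.of_le (by norm_num))]
  refine Prod.ext (by simp [e1]) ?_
  have h3 := h.fderiv_connCoeff
  rw [h0] at h3
  rw [Prod.snd_sub, e2]
  simp only [jacobiCoeff, h3, sub_apply, neg_apply, ContinuousLinearMap.comp_apply,
    ContinuousLinearMap.inl_apply, (hη.isSymmSndFDerivAt (by simp; norm_num)).eq z.2 k.1]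
  module

/-- If the eigenvector `e` of the Jacobi endomorphism for the eigenvalue `ν ^ 2` is parallel, that
is `e' = -(η' + Γ) e`, then `x = sin (ν t) e` gives the solution `(x, x' + η' x)` of the
linearization of `S - η^c`. -/
theorem hasDerivAt_linearized_solution (h0 : liftField η z = S z) {ν t : ℝ} {e : ℝ → E}
    (he : HasDerivAt e (-(fderiv ℝ η z.1 + connCoeff S z) (e t)) t)
    (hΦ : jacobiCoeff S z (e t) = ν ^ 2 • e t) :
    HasDerivAt (fun t ↦ (Real.sin (ν * t) • e t,
        (ν * Real.cos (ν * t)) • e t - Real.sin (ν * t) • connCoeff S z (e t)))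
      (fderiv ℝ (fun y ↦ S y - liftField η y) z (Real.sin (ν * t) • e t,
        (ν * Real.cos (ν * t)) • e t - Real.sin (ν * t) • connCoeff S z (e t))) t := by
  have hl : HasDerivAt (fun t : ℝ ↦ ν * t) ν t := by
    simpa using (hasDerivAt_id t).const_mul ν
  have hCe := (connCoeff S z).hasFDerivAt.comp_hasDerivAt t he
  have h1 := (hl.sin.smul he).prodMk (((hl.cos.const_mul ν).smul he).sub (hl.sin.smul hCe))
  refine h1.congr_deriv ?_
  rw [h.fderiv_sub_liftField h0]
  simp only [add_apply, map_add, map_neg, map_sub, map_smul, hΦ, Function.comp_apply]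
  refine Prod.ext ?_ ?_
  · simp only; module
  · simp only; module

end IsInfinitesimalSymmetryAt

/-- The solution `exp (-t N) w` of `e' = -N e` stays in an eigenspace of every `Φ` commuting
with `N`, and does not vanish. -/
theorem exists_parallel_eigenvector [CompleteSpace E] {N Φ : E →L[ℝ] E}
    (hc : N.comp Φ = Φ.comp N) {a : ℝ} {w : E} (hw : Φ w = a • w) (hw0 : w ≠ 0) :
    ∃ e : ℝ → E, ∀ t, HasDerivAt e (-N (e t)) t ∧ Φ (e t) = a • e t ∧ e t ≠ 0 := by
  let : NormedAlgebra ℚ (E →L[ℝ] E) := NormedAlgebra.restrictScalars ℚ ℝ _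
  refine ⟨fun t ↦ NormedSpace.exp (t • -N) w, fun t ↦ ⟨?_, ?_, ?_⟩⟩
  · have h1 := (hasDerivAt_exp_smul_const' (𝕂 := ℝ) (-N) t).clm_apply (hasDerivAt_const t w)
    simpa using h1
  · have h1 : Commute Φ (t • -N) := ((show Commute Φ N from hc.symm).neg_right).smul_right t
    have h2 := DFunLike.congr_fun (h1.exp_right (𝔸 := E →L[ℝ] E)).eq w
    simpa [hw] using h2
  · intro h0
    obtain ⟨u, hu⟩ := NormedSpace.isUnit_exp (t • -N)
    have h2 := DFunLike.congr_fun u.inv_mul w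
    rw [hu, mul_apply_eq_comp, show NormedSpace.exp (t • -N) w = 0 from h0, map_zero] at h2
    exact hw0 h2.symm

end CoordinateCalculus

/-! ### Variations of a zero of a vector field -/

section ODE

variable {V : Type*} [NormedAddCommGroup V] [NormedSpace ℝ V]

theorem gronwallBound_zero_left (K ε x : ℝ) :
    gronwallBound 0 K ε x = ε * gronwallBound 0 K 1 x := by
  unfold gronwallBound
  split_ifs <;> ring

/-- A bounded, globally Lipschitz vector field has integral curves on every compact interval. -/
theorem exists_hasDerivWithinAt_of_bounded [CompleteSpace V] {Q : V → V} {K L : ℝ≥0}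
    (hK : LipschitzWith K Q) (hL : ∀ x, ‖Q x‖ ≤ L) {a b : ℝ} (hab : a ≤ b) (x : V) :
    ∃ α : ℝ → V, α a = x ∧ ∀ t ∈ Icc a b, HasDerivWithinAt α (Q (α t)) (Icc a b) t := by
  have h : IsPicardLindelof (fun _ ↦ Q) (⟨a, left_mem_Icc.2 hab⟩ : Icc a b) x
      (L * ⟨b - a, sub_nonneg.2 hab⟩) 0 L K := by
    refine .of_time_independent (fun x _ ↦ hL x) hK.lipschitzOnWith ?_
    simp only [sub_self, max_eq_left (sub_nonneg.2 hab), NNReal.coe_zero, sub_zero]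
    exact le_rfl
  exact h.exists_eq_forall_mem_Icc_hasDerivWithinAt₀

/-- Cutting off a `C^1` vector field outside a neighbourhood of a point makes it bounded and
globally Lipschitz. -/
theorem exists_bounded_lipschitz_eventuallyEq [FiniteDimensional ℝ V] {R : V → V} {z : V}
    (hR : ContDiffAt ℝ 1 R z) :
    ∃ (Q : V → V) (K L : ℝ≥0), LipschitzWith K Q ∧ (∀ x, ‖Q x‖ ≤ L) ∧ Q =ᶠ[𝓝 z] R := by
  obtain ⟨u, hu, hRu⟩ := hR.eventually (by simp) |>.exists_mem
  obtain ⟨r, hr, hru⟩ := Metric.mem_nhds_iff.1 hu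
  let f : ContDiffBump z := ⟨r / 3, r / 2, by positivity, by linarith⟩
  have hsub : tsupport f ⊆ u := by
    rw [f.tsupport_eq]
    exact (Metric.closedBall_subset_ball (by change r / 2 < r; linarith)).trans hru
  have hQ : ContDiff ℝ 1 fun x ↦ f x • R x := by
    rw [contDiff_iff_contDiffAt]
    intro x
    by_cases hx : x ∈ tsupport f
    · exact f.contDiff.contDiffAt.smul (hRu x (hsub hx))
    · refine contDiffAt_const (c := (0 : V)) |>.congr_of_eventuallyEq ?_
      filter_upwards [(isClosed_tsupport f).isOpen_compl.mem_nhds hx] with y hy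
      rw [image_eq_zero_of_notMem_tsupport hy, zero_smul]
  have hs : HasCompactSupport fun x ↦ f x • R x := f.hasCompactSupport.smul_right
  obtain ⟨K, hK⟩ := hQ.lipschitzWith_of_hasCompactSupport hs (by norm_num)
  obtain ⟨L, hL⟩ := hs.exists_bound_of_continuous hQ.continuous
  refine ⟨_, K, L.toNNReal, hK, fun x ↦ (hL x).trans (Real.le_coe_toNNReal L), ?_⟩
  filter_upwards [f.eventuallyEq_one] with x hx
  simp [hx]

/-- Near a zero `z` of a vector field `R`, every solution `Y` of the linearized equation is the
variation field, at the constant integral curve `z`, of a family of integral curves of `R` on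
`[a, b]` that stay in a given neighbourhood of `z`. -/
theorem exists_variation_of_zero [FiniteDimensional ℝ V] {R : V → V} {z : V}
    (hR : ContDiffAt ℝ 1 R z) (h0 : R z = 0) {Y : ℝ → V}
    (hY : ∀ t, HasDerivAt Y (fderiv ℝ R z (Y t)) t) {O : Set V} (hO : O ∈ 𝓝 z) {a b : ℝ}
    (hab : a < b) :
    ∃ ε > 0, ∃ y : ℝ → ℝ → V,
      (∀ s ∈ Ioo (-ε) ε, ∀ t ∈ Icc a b,
        HasDerivWithinAt (y s) (R (y s t)) (Icc a b) t ∧ y s t ∈ O) ∧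
      ∀ t ∈ Icc a b, HasDerivAt (fun s ↦ y s t) (Y t) 0 ∧ y 0 t = z := by
  have : CompleteSpace V := FiniteDimensional.complete ℝ V
  obtain ⟨Q, K, L, hK, hL, hQR⟩ := exists_bounded_lipschitz_eventuallyEq hR
  have hQd : HasFDerivAt Q (fderiv ℝ R z) z :=
    (hR.differentiableAt (by norm_num)).hasFDerivAt.congr_of_eventuallyEq hQR
  have hQ0 : Q z = 0 := hQR.self_of_nhds.trans h0
  choose y hya hy using fun s : ℝ ↦
    exists_hasDerivWithinAt_of_bounded hK hL hab.le (z + s • Y a)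
  have hYc : Continuous Y := continuous_iff_continuousAt.2 fun t ↦ (hY t).continuousAt
  obtain ⟨M, hM⟩ := isCompact_Icc.exists_bound_of_continuousOn (hYc.continuousOn (s := Icc a b))
  have hM1 : ∀ t ∈ Icc a b, ‖Y t‖ ≤ |M| + 1 := fun t ht ↦
    (hM t ht).trans ((le_abs_self M).trans (by linarith))
  have hMpos : 0 < |M| + 1 := by positivity
  set C := gronwallBound 0 K 1 (b - a) with hC
  have hCmono := gronwallBound_mono (δ := 0) (ε := 1) (K := K) le_rfl zero_le_one K.2
  have hC0 : 0 ≤ C := by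
    have := hCmono (sub_nonneg.2 hab.le); rwa [gronwallBound_x0] at this
  -- The curve `z + s • Y` solves the equation up to an error `o(s)`, uniformly on `[a, b]`.
  have key : ∀ δ > 0, ∀ᶠ s : ℝ in 𝓝 0, ∀ t ∈ Icc a b,
      ‖y s t - (z + s • Y t)‖ ≤ δ * |s| := by
    intro δ hδ
    set δ' := δ / (C + 1) with hδ'
    have hδ'pos : 0 < δ' := by positivity
    have h1 := hQd.isLittleO.def (c := δ' / (|M| + 1)) (by positivity)
    obtain ⟨ρ, hρ, hball⟩ := Metric.eventually_nhds_iff.1 h1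
    filter_upwards [Metric.ball_mem_nhds (0 : ℝ) (div_pos hρ hMpos)] with s hs t ht
    rw [mem_ball_zero_iff, Real.norm_eq_abs, lt_div_iff₀ hMpos] at hs
    have hsY : ∀ t ∈ Icc a b, ‖s • Y t‖ ≤ |s| * (|M| + 1) := fun t ht ↦ by
      rw [norm_smul, Real.norm_eq_abs]; gcongr; exact hM1 t ht
    have hder : ∀ t, HasDerivAt (fun t ↦ z + s • Y t) (s • fderiv ℝ R z (Y t)) t := fun t ↦
      ((hY t).const_smul s).const_add z
    have h2 := dist_le_of_approx_trajectories_ODE (v := fun _ ↦ Q) (K := K) (δ := 0) (εf := 0)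
      (εg := δ' * |s|) (f := y s) (f' := fun t ↦ Q (y s t)) (g := fun t ↦ z + s • Y t)
      (g' := fun t ↦ s • fderiv ℝ R z (Y t)) (a := a) (b := b) (fun _ ↦ hK)
      (fun t ht ↦ (hy s t ht).continuousWithinAt)
      (fun t ht ↦ ((hy s t (Ico_subset_Icc_self ht)).mono_of_mem_nhdsWithin
        (Icc_mem_nhdsGE_of_mem ht)))
      (fun t _ ↦ by simp) (continuousOn_of_forall_continuousAt fun t _ ↦ (hder t).continuousAt)
      (fun t _ ↦ (hder t).hasDerivWithinAt)
      (fun t ht ↦ ?_) (by simp [hya]) t ht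
    · rw [dist_eq_norm, zero_add, gronwallBound_zero_left] at h2
      refine h2.trans ?_
      have h3 : gronwallBound 0 K 1 (t - a) ≤ C := hCmono (by linarith [ht.2])
      calc δ' * |s| * gronwallBound 0 K 1 (t - a) ≤ δ' * |s| * (C + 1) := by gcongr; linarith
        _ = δ * |s| := by rw [hδ']; field_simp
    · have ht' := Ico_subset_Icc_self ht
      have h4 := hball (y := z + s • Y t) (by
        rw [dist_eq_norm, add_sub_cancel_left]; exact (hsY t ht').trans_lt hs)
      rw [hQ0, add_sub_cancel_left, sub_zero, map_smul] at h4
      rw [dist_comm, dist_eq_norm]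
      refine h4.trans ?_
      calc δ' / (|M| + 1) * ‖s • Y t‖ ≤ δ' / (|M| + 1) * (|s| * (|M| + 1)) := by
            gcongr; exact hsY t ht'
        _ = δ' * |s| := by field_simp
  have hy0 : ∀ t ∈ Icc a b, y 0 t = z := fun t ht ↦ by
    simpa [sub_eq_zero] using (key 1 one_pos).self_of_nhds t ht
  -- for small `s` the curves stay where `Q` and `R` agree
  obtain ⟨r, hr, hrO⟩ := Metric.mem_nhds_iff.1 (inter_mem hO hQR)
  have hsmall : ∀ᶠ s : ℝ in 𝓝 0, ∀ t ∈ Icc a b, y s t ∈ Metric.ball z r := by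
    have h5 : ∀ᶠ s : ℝ in 𝓝 0, |s| * (1 + (|M| + 1)) < r := by
      have : ContinuousAt (fun s : ℝ ↦ |s| * (1 + (|M| + 1))) 0 := by fun_prop
      exact this.eventually_lt continuousAt_const (by simpa using hr)
    filter_upwards [key 1 one_pos, h5] with s hs hs' t ht
    rw [mem_ball_iff_norm]
    calc ‖y s t - z‖ = ‖(y s t - (z + s • Y t)) + s • Y t‖ := by congr 1; abel
      _ ≤ 1 * |s| + |s| * (|M| + 1) := by
        refine (norm_add_le _ _).trans (add_le_add (hs t ht) ?_)
        rw [norm_smul, Real.norm_eq_abs]; gcongr; exact hM1 t ht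
      _ < r := by linarith
  obtain ⟨ε, hε, hball⟩ := Metric.eventually_nhds_iff.1 hsmall
  refine ⟨ε, hε, y, fun s hs t ht ↦ ?_, fun t ht ↦ ⟨?_, hy0 t ht⟩⟩
  · have h6 := hrO (hball (y := s) (by rwa [dist_zero_right, Real.norm_eq_abs, abs_lt]) t ht)
    refine ⟨?_, h6.1⟩
    rw [← show Q (y s t) = R (y s t) from h6.2]
    exact hy s t ht
  · rw [hasDerivAt_iff_isLittleO, Asymptotics.isLittleO_iff]
    intro δ hδ
    filter_upwards [key δ hδ] with s hs
    rw [hy0 t ht, sub_zero, Real.norm_eq_abs, sub_sub]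
    exact hs t ht

end ODE

/-! ### Smoothness of tangent maps and integral curves -/

section SmoothFields

variable {E : Type*} [NormedAddCommGroup E] [NormedSpace ℝ E]
  {H : Type*} [TopologicalSpace H] {I : ModelWithCorners ℝ E H}
  {N : Type*} [TopologicalSpace N] [ChartedSpace H N]
  {F H' B : Type*} [NormedAddCommGroup F] [NormedSpace ℝ F] [TopologicalSpace H']
    {J : ModelWithCorners ℝ F H'} [TopologicalSpace B] [ChartedSpace H' B]
  {F' H'' C : Type*} [NormedAddCommGroup F'] [NormedSpace ℝ F'] [TopologicalSpace H'']
    {K : ModelWithCorners ℝ F' H''} [TopologicalSpace C] [ChartedSpace H'' C]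
  [IsManifold I ∞ N] [IsManifold J ∞ B] [IsManifold K ∞ C]

theorem comp_one_smulRight {V W : Type*} [AddCommGroup V] [Module ℝ V] [TopologicalSpace V]
    [ContinuousSMul ℝ V] [AddCommGroup W] [Module ℝ W] [TopologicalSpace W] [ContinuousSMul ℝ W]
    (L : V →L[ℝ] W) (v : V) :
    L.comp ((1 : ℝ →L[ℝ] ℝ).smulRight v) = (1 : ℝ →L[ℝ] ℝ).smulRight (L v) := by
  ext; simp

/-- The tangent maps of a smooth family are jointly smooth: they are the tangent map of
`N × B → C` on the vectors `(0, w)`. -/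
theorem contMDiff_tangentMap_param {f : N → B → C}
    (hf : ContMDiff (I.prod J) K ∞ (fun p : N × B ↦ f p.1 p.2)) :
    ContMDiff (I.prod J.tangent) K.tangent ∞
      (fun p : N × TangentBundle J B ↦ tangentMap J K (f p.1) p.2) := by
  have h1 : ContMDiff (I.prod J.tangent) (I.prod J).tangent ∞
      (fun p : N × TangentBundle J B ↦ (equivTangentBundleProd I N J B).symm
        (Bundle.zeroSection E (TangentSpace I : N → Type _) p.1, p.2)) :=
    contMDiff_equivTangentBundleProd_symm.comp
      (((Bundle.contMDiff_zeroSection ℝ (TangentSpace I : N → Type _)).comp contMDiff_fst).prodMk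
        contMDiff_snd)
  refine ((hf.contMDiff_tangentMap (m := ∞) (by simp)).comp h1).congr fun p ↦ ?_
  have h2 : MDifferentiableAt (I.prod J) K (fun p : N × B ↦ f p.1 p.2) (p.1, p.2.1) :=
    hf.mdifferentiableAt (by simp)
  simp only [Function.comp_apply, tangentMap]
  congr 1
  have h3 := mfderiv_prod_eq_add_apply (v := ((0, p.2.2) : E × F)) h2
  refine Eq.trans ?_ h3.symm
  exact ((congrArg (· + _) (map_zero (mfderiv I K (fun z ↦ f z p.2.proj) p.1))).trans
    (zero_add _)).symm

/-- The expression of a smooth vector field in a chart is smooth. -/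
theorem contDiffOn_chartField [I.Boundaryless] {v : (x : N) → TangentSpace I x}
    (hv : ContMDiff I I.tangent ∞ (fun x ↦ (⟨x, v x⟩ : TangentBundle I N))) (x₀ : N) :
    ContDiffOn ℝ ∞ (fun z ↦ tangentCoordChange I ((extChartAt I x₀).symm z) x₀
      ((extChartAt I x₀).symm z) (v ((extChartAt I x₀).symm z))) (extChartAt I x₀).target := by
  have h1 : ContMDiffOn 𝓘(ℝ, E) I.tangent ∞
      (fun z ↦ (⟨(extChartAt I x₀).symm z, v ((extChartAt I x₀).symm z)⟩ : TangentBundle I N))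
      (extChartAt I x₀).target :=
    hv.comp_contMDiffOn (contMDiffOn_extChartAt_symm x₀)
  have h2 := (contMDiffOn_extChartAt (I := I.tangent) (n := ∞)
    (x := (⟨x₀, v x₀⟩ : TangentBundle I N))).comp h1 (fun z hz ↦ by
      simpa using (extChartAt I x₀).map_target hz)
  have h3 := (contMDiffOn_iff_contDiffOn (E := E) (E' := E × E)).1 h2
  exact h3.snd

/-- Integral curves of smooth vector fields are smooth. -/
theorem contMDiff_of_isMIntegralCurve [I.Boundaryless] [CompleteSpace E]
    {v : (x : N) → TangentSpace I x}
    (hv : ContMDiff I I.tangent ∞ (fun x ↦ (⟨x, v x⟩ : TangentBundle I N))) {γ : ℝ → N}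
    (hγ : IsMIntegralCurve γ v) : ContMDiff 𝓘(ℝ, ℝ) I ∞ γ := by
  intro t₀
  have h1 := (hγ.isMIntegralCurveAt t₀).eventually_hasDerivAt
  have h2 := hγ.continuous.continuousAt.eventually (extChartAt_source_mem_nhds (I := I) (γ t₀))
  obtain ⟨r, hr, hball⟩ := Metric.nhds_basis_closedBall.eventually_iff.1 (h1.and h2)
  rw [Real.closedBall_eq_Icc] at hball
  have h3 := ODE.contDiffOn_enat_Icc_of_hasDerivWithinAt (n := ⊤) (tmin := t₀ - r) (tmax := t₀ + r)
    (f := fun _ z ↦ tangentCoordChange I ((extChartAt I (γ t₀)).symm z) (γ t₀)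
      ((extChartAt I (γ t₀)).symm z) (v ((extChartAt I (γ t₀)).symm z)))
    (α := extChartAt I (γ t₀) ∘ γ) (u := (extChartAt I (γ t₀)).target)
    ((contDiffOn_chartField hv (γ t₀)).comp contDiffOn_snd fun p hp ↦ hp.2)
    (fun t ht ↦ by
      have := (hball ht).1.hasDerivWithinAt (s := Icc (t₀ - r) (t₀ + r))
      rw [Function.comp_apply, (extChartAt I (γ t₀)).left_inv (hball ht).2]
      exact this)
    (fun t ht ↦ (extChartAt I (γ t₀)).map_source (hball ht).2)
  rw [contMDiffAt_iff]
  refine ⟨hγ.continuous.continuousAt, ?_⟩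
  have h4 : ContDiffAt ℝ ∞ (extChartAt I (γ t₀) ∘ γ) t₀ :=
    h3.contDiffAt (Icc_mem_nhds (by linarith) (by linarith))
  simpa using! h4.contDiffWithinAt

end SmoothFields

/-! ### One-parameter subgroups and fundamental vector fields -/

section LieGroup

variable {F : Type*} [NormedAddCommGroup F] [NormedSpace ℝ F]
  {G : Type*} [TopologicalSpace G] [ChartedSpace F G] [Group G] [LieGroup 𝓘(ℝ, F) ∞ G]

theorem contMDiff_mulInvariantVectorField_infty (ξ : GroupLieAlgebra 𝓘(ℝ, F) G) :
    ContMDiff 𝓘(ℝ, F) 𝓘(ℝ, F).tangent ∞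
      (fun g ↦ (⟨g, mulInvariantVectorField ξ g⟩ : TangentBundle 𝓘(ℝ, F) G)) := by
  have h1 := contMDiff_tangentMap_param (I := 𝓘(ℝ, F)) (J := 𝓘(ℝ, F)) (K := 𝓘(ℝ, F))
    (f := fun g h : G ↦ g * h) (contMDiff_mul 𝓘(ℝ, F) ∞)
  have h2 : ContMDiff 𝓘(ℝ, F) (𝓘(ℝ, F).prod 𝓘(ℝ, F).tangent) ∞
      (fun g : G ↦ (g, (⟨1, ξ⟩ : TangentBundle 𝓘(ℝ, F) G))) :=
    contMDiff_id.prodMk contMDiff_const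
  refine (h1.comp h2).congr fun g ↦ ?_
  exact Bundle.TotalSpace.ext (mul_one g).symm HEq.rfl

theorem mfderiv_mul_left_mulInvariantVectorField (ξ : GroupLieAlgebra 𝓘(ℝ, F) G) (g h : G) :
    mfderiv 𝓘(ℝ, F) 𝓘(ℝ, F) (g * ·) h (mulInvariantVectorField ξ h) =
      mulInvariantVectorField ξ (g * h) := by
  have h1 : ∀ (a b : G), MDifferentiableAt 𝓘(ℝ, F) 𝓘(ℝ, F) (a * ·) b := fun a b ↦
    (contMDiff_mul_left (I := 𝓘(ℝ, F)) (n := ∞) (a := a)).mdifferentiableAt (by simp)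
  have h2 := mfderiv_comp_of_eq (h1 g h) (h1 h 1) (mul_one h)
  have h3 : (fun x ↦ g * x) ∘ (fun x ↦ h * x) = fun x ↦ g * h * x := by
    ext; simp [mul_assoc]
  rw [h3] at h2
  have h4 : ∀ k, k = h → (mfderiv 𝓘(ℝ, F) 𝓘(ℝ, F) (g * ·) k : F →L[ℝ] F) =
      mfderiv 𝓘(ℝ, F) 𝓘(ℝ, F) (g * ·) h := by rintro _ rfl; rfl
  exact ((DFunLike.congr_fun h2 ξ).trans (DFunLike.congr_fun (h4 (h * 1) (mul_one h))
    (mulInvariantVectorField ξ h))).symm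

theorem isMIntegralCurveOn_mul_left {ξ : GroupLieAlgebra 𝓘(ℝ, F) G} {γ : ℝ → G} {s : Set ℝ}
    (hγ : IsMIntegralCurveOn γ (mulInvariantVectorField ξ) s) (g : G) :
    IsMIntegralCurveOn (fun t ↦ g * γ t) (mulInvariantVectorField ξ) s := by
  intro t ht
  have h1 : MDifferentiableAt 𝓘(ℝ, F) 𝓘(ℝ, F) (g * ·) (γ t) :=
    (contMDiff_mul_left (I := 𝓘(ℝ, F)) (n := ∞) (a := g)).mdifferentiableAt (by simp)
  refine (h1.hasMFDerivAt.comp_hasMFDerivWithinAt t (hγ t ht)).congr_mfderiv ?_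
  rw [← mfderiv_mul_left_mulInvariantVectorField]
  exact comp_one_smulRight ..

theorem isMIntegralCurve_mul_left {ξ : GroupLieAlgebra 𝓘(ℝ, F) G} {γ : ℝ → G}
    (hγ : IsMIntegralCurve γ (mulInvariantVectorField ξ)) (g : G) :
    IsMIntegralCurve (fun t ↦ g * γ t) (mulInvariantVectorField ξ) :=
  isMIntegralCurve_iff_isMIntegralCurveOn.2
    (isMIntegralCurveOn_mul_left (hγ.isMIntegralCurveOn univ) g)

/-- Left-invariant vector fields are complete. -/
theorem exists_isMIntegralCurve_mulInvariantVectorField [T2Space G] [CompleteSpace F]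
    (ξ : GroupLieAlgebra 𝓘(ℝ, F) G) :
    ∃ γ : ℝ → G, γ 0 = 1 ∧ IsMIntegralCurve γ (mulInvariantVectorField ξ) := by
  have hv := (contMDiff_mulInvariantVectorField_infty ξ).of_le (m := 1) (by simp)
  obtain ⟨γ, hγ0, hγ⟩ := exists_isMIntegralCurveAt_of_contMDiffAt_boundaryless
    (t₀ := 0) (hv.contMDiffAt (x := (1 : G)))
  obtain ⟨ε, hε, h⟩ := isMIntegralCurveAt_iff'.1 hγ
  rw [Real.ball_eq_Ioo, zero_sub, zero_add] at h
  exact exists_isMIntegralCurve_of_isMIntegralCurveOn hv hε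
    (fun g ↦ ⟨fun t ↦ g * γ t, by simp [hγ0], isMIntegralCurveOn_mul_left h g⟩) 1

theorem eq_of_isMIntegralCurve_mulInvariantVectorField [T2Space G] [CompleteSpace F]
    {ξ : GroupLieAlgebra 𝓘(ℝ, F) G} {γ γ' : ℝ → G}
    (hγ : IsMIntegralCurve γ (mulInvariantVectorField ξ))
    (hγ' : IsMIntegralCurve γ' (mulInvariantVectorField ξ)) (h : γ 0 = γ' 0) : γ = γ' :=
  isMIntegralCurve_Ioo_eq_of_contMDiff_boundaryless
    ((contMDiff_mulInvariantVectorField_infty ξ).of_le (m := 1) (by simp)) hγ hγ' h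

/-- Integral curves of left-invariant vector fields through `1` are one-parameter subgroups. -/
theorem map_add_of_isMIntegralCurve [T2Space G] [CompleteSpace F]
    {ξ : GroupLieAlgebra 𝓘(ℝ, F) G} {γ : ℝ → G} (h0 : γ 0 = 1)
    (hγ : IsMIntegralCurve γ (mulInvariantVectorField ξ)) (s t : ℝ) :
    γ (s + t) = γ s * γ t := by
  have h1 := eq_of_isMIntegralCurve_mulInvariantVectorField (hγ.comp_add s)
    (isMIntegralCurve_mul_left hγ (γ s)) (by simp [h0])
  simpa [add_comm] using congr_fun h1 t

theorem lieExp_smul_eq [T2Space G] [CompleteSpace F]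
    {ξ : GroupLieAlgebra 𝓘(ℝ, F) G} {γ : ℝ → G} (h0 : γ 0 = 1)
    (hγ : IsMIntegralCurve γ (mulInvariantVectorField ξ)) (t : ℝ) : lieExp (t • ξ) = γ t := by
  have h : ∃ γ : ℝ → G, γ 0 = 1 ∧ IsMIntegralCurve γ (mulInvariantVectorField (t • ξ)) :=
    exists_isMIntegralCurve_mulInvariantVectorField (t • ξ)
  have h1 := hγ.comp_mul t
  rw [← mulInvariantVectorField_smul] at h1
  have h2 := eq_of_isMIntegralCurve_mulInvariantVectorField h.choose_spec.2 h1
    (by rw [h.choose_spec.1]; simp [h0])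
  rw [lieExp, dif_pos h, h2]
  simp

variable {E : Type*} [NormedAddCommGroup E] [NormedSpace ℝ E]
  {M : Type*} [TopologicalSpace M] [ChartedSpace E M] [MulAction G M]
  [ContMDiffSMul 𝓘(ℝ, F) 𝓘(ℝ, E) ∞ G M]

theorem contMDiff_fundamentalField [IsManifold 𝓘(ℝ, E) ∞ M]
    (ξ : GroupLieAlgebra 𝓘(ℝ, F) G) :
    ContMDiff 𝓘(ℝ, E) 𝓘(ℝ, E).tangent ∞
      (fun m ↦ (⟨m, fundamentalField ξ m⟩ : TangentBundle 𝓘(ℝ, E) M)) := by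
  have h0 : ContMDiff (𝓘(ℝ, E).prod 𝓘(ℝ, F)) 𝓘(ℝ, E) ∞ (fun p : M × G ↦ p.2 • p.1) :=
    (contMDiff_smul (I := 𝓘(ℝ, F)) (I' := 𝓘(ℝ, E)) (n := ∞) (G := G) (M := M)).comp
      (contMDiff_snd.prodMk contMDiff_fst)
  have h1 := contMDiff_tangentMap_param (f := fun (m : M) (g : G) ↦ g • m) h0
  have h2 : ContMDiff 𝓘(ℝ, E) (𝓘(ℝ, E).prod 𝓘(ℝ, F).tangent) ∞
      (fun m : M ↦ (m, (⟨1, ξ⟩ : TangentBundle 𝓘(ℝ, F) G))) :=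
    contMDiff_id.prodMk contMDiff_const
  refine (h1.comp h2).congr fun m ↦ ?_
  exact Bundle.TotalSpace.ext (one_smul G m).symm HEq.rfl

/-- The orbits of the one-parameter subgroup generated by `ξ` are the integral curves of the
fundamental vector field of `ξ`. -/
theorem isMIntegralCurve_smul [T2Space G] [CompleteSpace F]
    {ξ : GroupLieAlgebra 𝓘(ℝ, F) G} {γ : ℝ → G} (h0 : γ 0 = 1)
    (hγ : IsMIntegralCurve γ (mulInvariantVectorField ξ)) (m : M) :
    IsMIntegralCurve (I := 𝓘(ℝ, E)) (fun t ↦ γ t • m) (fundamentalField ξ) := by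
  intro t
  have h1 : (fun s ↦ γ s • m) = (fun g : G ↦ g • (γ t • m)) ∘ (γ ∘ (· + -t)) := by
    ext s
    simp only [Function.comp_apply]
    rw [smul_smul, ← map_add_of_isMIntegralCurve h0 hγ, neg_add_cancel_right]
  have h2 : MDifferentiableAt 𝓘(ℝ, F) 𝓘(ℝ, E) (fun g : G ↦ g • (γ t • m))
      ((γ ∘ (· + -t)) t) :=
    ((contMDiff_smul (I := 𝓘(ℝ, F)) (I' := 𝓘(ℝ, E)) (n := ∞) (G := G) (M := M)).comp
      (contMDiff_id.prodMk contMDiff_const)).mdifferentiableAt (by simp)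
  have h3 : γ (t + -t) = 1 := by simp [h0]
  have h4 : mulInvariantVectorField ξ (1 : G) = ξ := by
    have : (fun x : G ↦ 1 * x) = id := by ext; simp
    have h5 : mfderiv 𝓘(ℝ, F) 𝓘(ℝ, F) (fun x : G ↦ 1 * x) 1 = ContinuousLinearMap.id ℝ F :=
      ((hasMFDerivAt_id (1 : G)).congr_of_eventuallyEq (EventuallyEq.of_eq this)).mfderiv
    exact DFunLike.congr_fun h5 ξ
  have h5 := h2.hasMFDerivAt.comp t (hγ.comp_add (-t) t)
  rw [← h1] at h5
  refine h5.congr_mfderiv ?_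
  refine (comp_one_smulRight ..).trans ?_
  congr 1
  simp only [fundamentalField, Function.comp_apply]
  rw [h3, h4]
  rfl

theorem eq_smul_of_isMIntegralCurve_fundamentalField [IsManifold 𝓘(ℝ, E) ∞ M] [T2Space G]
    [T2Space M] [CompleteSpace F] [CompleteSpace E]
    {ξ : GroupLieAlgebra 𝓘(ℝ, F) G} {γ : ℝ → G} (h0 : γ 0 = 1)
    (hγ : IsMIntegralCurve γ (mulInvariantVectorField ξ)) {c : ℝ → M}
    (hc : IsMIntegralCurve (I := 𝓘(ℝ, E)) c (fundamentalField ξ)) : c = fun t ↦ γ t • c 0 :=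
  isMIntegralCurve_Ioo_eq_of_contMDiff_boundaryless (t₀ := 0)
    ((contMDiff_fundamentalField ξ).of_le (m := 1) (by simp)) hc
    (isMIntegralCurve_smul h0 hγ (c 0)) (by simp [h0])

end LieGroup

/-! ### Mixed derivatives of one-parameter families -/

section Swap

variable {V W : Type*} [NormedAddCommGroup V] [NormedSpace ℝ V] [NormedAddCommGroup W]
  [NormedSpace ℝ W]

theorem fderiv_prodMk_right {φ : ℝ → V → W} {t : ℝ} {z : V}
    (hφ : DifferentiableAt ℝ (fun p : ℝ × V ↦ φ p.1 p.2) (t, z)) :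
    fderiv ℝ (φ t) z =
      (fderiv ℝ (fun p : ℝ × V ↦ φ p.1 p.2) (t, z)).comp (ContinuousLinearMap.inr ℝ ℝ V) :=
  (HasFDerivAt.comp (f := fun z ↦ (t, z)) z hφ.hasFDerivAt (hasFDerivAt_prodMk_right t z)).fderiv

theorem hasDerivAt_prodMk_left {φ : ℝ → V → W} {t : ℝ} {z : V}
    (hφ : DifferentiableAt ℝ (fun p : ℝ × V ↦ φ p.1 p.2) (t, z)) :
    HasDerivAt (fun t ↦ φ t z) (fderiv ℝ (fun p : ℝ × V ↦ φ p.1 p.2) (t, z) (1, 0)) t := by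
  simpa using! (HasFDerivAt.comp (f := fun t ↦ (t, z)) t hφ.hasFDerivAt
    (hasFDerivAt_prodMk_left t z)).hasDerivAt

/-- The time derivative commutes with the space derivative. -/
theorem hasDerivAt_fderiv_swap {φ : ℝ → V → W} {t : ℝ} {z : V}
    (hφ : ContDiffAt ℝ 2 (fun p : ℝ × V ↦ φ p.1 p.2) (t, z)) :
    HasDerivAt (fun s ↦ fderiv ℝ (φ s) z) (fderiv ℝ (fun y ↦ deriv (fun s ↦ φ s y) t) z) t := by
  set Φ : ℝ × V → W := fun p ↦ φ p.1 p.2 with hΦ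
  have hd : ∀ᶠ p in 𝓝 (t, z), DifferentiableAt ℝ Φ p :=
    (hφ.eventually (by simp)).mono fun p hp ↦ hp.differentiableAt (by norm_num)
  have h2 : HasFDerivAt (fderiv ℝ Φ) (fderiv ℝ (fderiv ℝ Φ) (t, z)) (t, z) :=
    ((hφ.fderiv_right (m := 1) (by norm_num)).differentiableAt (by norm_num)).hasFDerivAt
  have e1 : (fun s ↦ fderiv ℝ (φ s) z) =ᶠ[𝓝 t]
      fun s ↦ (fderiv ℝ Φ (s, z)).comp (ContinuousLinearMap.inr ℝ ℝ V) := by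
    have : ContinuousAt (fun s : ℝ ↦ (s, z)) t := by fun_prop
    filter_upwards [this.eventually hd] with s hs using fderiv_prodMk_right hs
  have e2 : (fun y ↦ deriv (fun s ↦ φ s y) t) =ᶠ[𝓝 z] fun y ↦ fderiv ℝ Φ (t, y) (1, 0) := by
    have : ContinuousAt (fun y : V ↦ (t, y)) z := by fun_prop
    filter_upwards [this.eventually hd] with y hy using (hasDerivAt_prodMk_left hy).deriv
  have h3 : HasDerivAt (fun s ↦ fderiv ℝ Φ (s, z)) (fderiv ℝ (fderiv ℝ Φ) (t, z) (1, 0)) t := by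
    simpa using! (HasFDerivAt.comp (f := fun t ↦ (t, z)) t h2
      (hasFDerivAt_prodMk_left t z)).hasDerivAt
  have h4 : HasFDerivAt (fun y ↦ fderiv ℝ Φ (t, y) (1, 0))
      (((fderiv ℝ (fderiv ℝ Φ) (t, z)).comp (ContinuousLinearMap.inr ℝ ℝ V)).flip (1, 0)) z := by
    simpa using (HasFDerivAt.comp (f := fun y ↦ (t, y)) z h2
      (hasFDerivAt_prodMk_right t z)).clm_apply (hasFDerivAt_const ((1 : ℝ), (0 : V)) z)
  rw [e2.fderiv_eq, h4.fderiv]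
  refine ((h3.clm_comp (hasDerivAt_const t (ContinuousLinearMap.inr ℝ ℝ V))).congr_of_eventuallyEq
    e1).congr_deriv ?_
  ext u
  simpa using (hφ.isSymmSndFDerivAt (by simp)).eq (1, 0) (0, u)

/-- A vector field invariant under a flow commutes with the generator of the flow. -/
theorem fderiv_comm_of_equivariant {φ : ℝ → V → V} {S : V → V} {z : V}
    (hφ : ContDiffAt ℝ 2 (fun p : ℝ × V ↦ φ p.1 p.2) (0, z)) (h0 : φ 0 z = z)
    (hS : DifferentiableAt ℝ S z)
    (he : ∀ᶠ t in 𝓝 0, fderiv ℝ (φ t) z (S z) = S (φ t z)) :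
    fderiv ℝ S z (deriv (fun t ↦ φ t z) 0) =
      fderiv ℝ (fun y ↦ deriv (fun t ↦ φ t y) 0) z (S z) := by
  have h1 := (hasDerivAt_fderiv_swap hφ).clm_apply (hasDerivAt_const (0 : ℝ) (S z))
  have h2 : HasDerivAt (fun t ↦ φ t z) (deriv (fun t ↦ φ t z) 0) 0 :=
    (hasDerivAt_prodMk_left (hφ.differentiableAt (by norm_num))).differentiableAt.hasDerivAt
  have h3 := HasFDerivAt.comp_hasDerivAt (f := fun t ↦ φ t z) (l := S) (0 : ℝ)
    (l' := fderiv ℝ S z) (by rw [h0]; exact hS.hasFDerivAt) h2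
  simpa using h3.unique (h1.congr_of_eventuallyEq (EventuallyEq.symm he))

end Swap

/-! ### Smooth flows in charts -/

section Flow

variable {E : Type*} [NormedAddCommGroup E] [NormedSpace ℝ E]
  {H : Type*} [TopologicalSpace H] {I : ModelWithCorners ℝ E H}
  {N : Type*} [TopologicalSpace N] [ChartedSpace H N]

/-- A smooth global flow, that is a smooth action of `ℝ`, on a manifold. -/
structure IsSmoothFlow (I : ModelWithCorners ℝ E H) (ψ : ℝ → N → N) : Prop where
  smooth : ContMDiff (𝓘(ℝ, ℝ).prod I) I ∞ (fun p : ℝ × N ↦ ψ p.1 p.2)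
  zero : ∀ x, ψ 0 x = x
  add : ∀ s t x, ψ (s + t) x = ψ s (ψ t x)

/-- The expression of the maps `ψ t` in the charts at `x₀` and `x₁`. -/
def chartFlow (I : ModelWithCorners ℝ E H) (ψ : ℝ → N → N) (x₀ x₁ : N) (t : ℝ) (z : E) : E :=
  extChartAt I x₁ (ψ t ((extChartAt I x₀).symm z))

/-- The expression of the infinitesimal generator of `ψ` in the chart at `x₀`. -/
def chartGenerator (I : ModelWithCorners ℝ E H) (ψ : ℝ → N → N) (x₀ : N) (z : E) : E :=
  deriv (fun t ↦ chartFlow I ψ x₀ x₀ t z) 0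

/-- The expression of a vector field in the chart at `x₀`. -/
def chartField (v : (x : N) → TangentSpace I x) [IsManifold I 1 N] (x₀ : N) (z : E) : E :=
  tangentCoordChange I ((extChartAt I x₀).symm z) x₀ ((extChartAt I x₀).symm z)
    (v ((extChartAt I x₀).symm z))

variable {ψ : ℝ → N → N} {x₀ x₁ : N} {t : ℝ} {z : E}

theorem hasMFDerivAt_extChartAt_tangentCoordChange [IsManifold I 1 N] {x : N}
    (hx : x ∈ (extChartAt I x₀).source) :
    HasMFDerivAt I 𝓘(ℝ, E) (extChartAt I x₀) x (tangentCoordChange (E := E) I x x₀ x) := by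
  rw [extChartAt_source] at hx
  rw [← mfderiv_chartAt_eq_tangentCoordChange hx]
  exact hasMFDerivAt_extChartAt hx

namespace IsSmoothFlow

variable (hψ : IsSmoothFlow I ψ)
include hψ

theorem contMDiff (t : ℝ) : ContMDiff I I ∞ (ψ t) :=
  hψ.smooth.comp (contMDiff_const.prodMk contMDiff_id)

theorem mfderiv_eq_zero_iff {x : N} {w : TangentSpace I x} :
    mfderiv I I (ψ t) x w = 0 ↔ w = 0 := by
  refine ⟨fun h ↦ ?_, fun h ↦ by rw [h, map_zero]⟩
  have h1 := mfderiv_comp x ((hψ.contMDiff (-t)).mdifferentiableAt (by simp) (x := ψ t x))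
    ((hψ.contMDiff t).mdifferentiableAt (by simp) (x := x))
  have h2 : ψ (-t) ∘ ψ t = id := by
    ext
    simp [← hψ.add, hψ.zero]
  rw [h2, mfderiv_id] at h1
  refine (DFunLike.congr_fun h1 w).trans ?_
  exact (congrArg (mfderiv I I (ψ (-t)) (ψ t x)) h).trans (map_zero _)

theorem continuous_orbit (x : N) : Continuous fun t ↦ ψ t x :=
  hψ.smooth.continuous.comp (continuous_id.prodMk continuous_const)

theorem eventually_mem_source (x₀ x : N) (h : ψ t x ∈ (extChartAt I x₀).source) :
    ∀ᶠ s in 𝓝 t, ψ s x ∈ (extChartAt I x₀).source :=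
  (hψ.continuous_orbit x).continuousAt.eventually ((isOpen_extChartAt_source x₀).mem_nhds h)

theorem chartFlow_zero (hz : z ∈ (extChartAt I x₀).target) : chartFlow I ψ x₀ x₀ 0 z = z := by
  rw [chartFlow, hψ.zero, (extChartAt I x₀).right_inv hz]

theorem zero_mem_source (hz : z ∈ (extChartAt I x₀).target) :
    ψ 0 ((extChartAt I x₀).symm z) ∈ (extChartAt I x₀).source := by
  rw [hψ.zero]; exact (extChartAt I x₀).map_target hz

variable [IsManifold I ∞ N] [I.Boundaryless]

theorem contDiffAt_chartFlow (hz : z ∈ (extChartAt I x₀).target)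
    (ht : ψ t ((extChartAt I x₀).symm z) ∈ (extChartAt I x₁).source) :
    ContDiffAt ℝ ∞ (fun p : ℝ × E ↦ chartFlow I ψ x₀ x₁ p.1 p.2) (t, z) := by
  rw [← contMDiffAt_iff_contDiffAt]
  have h1 : ContMDiffAt 𝓘(ℝ, E) I ∞ (extChartAt I x₀).symm z :=
    (contMDiffOn_extChartAt_symm x₀).contMDiffAt ((isOpen_extChartAt_target x₀).mem_nhds hz)
  have h2 : ContMDiffAt 𝓘(ℝ, ℝ × E) (𝓘(ℝ, ℝ).prod I) ∞
      (fun p : ℝ × E ↦ (p.1, (extChartAt I x₀).symm p.2)) (t, z) :=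
    contDiff_fst.contMDiff.contMDiffAt.prodMk
      (ContMDiffAt.comp (f := Prod.snd) (t, z) h1 contDiff_snd.contMDiff.contMDiffAt)
  have h3 : ContMDiffAt I 𝓘(ℝ, E) ∞ (extChartAt I x₁) (ψ t ((extChartAt I x₀).symm z)) :=
    contMDiffAt_extChartAt' (by rwa [extChartAt_source] at ht)
  have h4 : ContMDiffAt 𝓘(ℝ, ℝ × E) I ∞
      (fun p : ℝ × E ↦ ψ p.1 ((extChartAt I x₀).symm p.2)) (t, z) :=
    ContMDiffAt.comp (g := fun p : ℝ × N ↦ ψ p.1 p.2)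
      (f := fun p : ℝ × E ↦ (p.1, (extChartAt I x₀).symm p.2)) (t, z) hψ.smooth.contMDiffAt h2
  exact ContMDiffAt.comp (g := extChartAt I x₁)
    (f := fun p : ℝ × E ↦ ψ p.1 ((extChartAt I x₀).symm p.2)) (t, z) h3 h4

theorem differentiableAt_chartFlow (hz : z ∈ (extChartAt I x₀).target)
    (ht : ψ t ((extChartAt I x₀).symm z) ∈ (extChartAt I x₁).source) :
    DifferentiableAt ℝ (chartFlow I ψ x₀ x₁ t) z :=
  (((hψ.contDiffAt_chartFlow hz ht).comp z
    (contDiffAt_const.prodMk contDiffAt_id)).differentiableAt (by simp) :)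

/-- The tangent map of `ψ t` in charts. -/
theorem fderiv_chartFlow_tangentCoordChange {x : N} (hx : x ∈ (extChartAt I x₀).source)
    (ht : ψ t x ∈ (extChartAt I x₁).source) (w : TangentSpace I x) :
    fderiv ℝ (chartFlow I ψ x₀ x₁ t) (extChartAt I x₀ x) (tangentCoordChange I x x₀ x w) =
      tangentCoordChange I (ψ t x) x₁ (ψ t x) (mfderiv I I (ψ t) x w) := by
  have hd : DifferentiableAt ℝ (chartFlow I ψ x₀ x₁ t) (extChartAt I x₀ x) :=
    hψ.differentiableAt_chartFlow ((extChartAt I x₀).map_source hx)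
      (by rwa [(extChartAt I x₀).left_inv hx])
  have h1 := hd.hasFDerivAt.hasMFDerivAt.comp x (hasMFDerivAt_extChartAt_tangentCoordChange hx)
  have h2 := (hasMFDerivAt_extChartAt_tangentCoordChange ht).comp x
    ((hψ.contMDiff t).mdifferentiableAt (by simp)).hasMFDerivAt
  have h3 : extChartAt I x₁ ∘ ψ t =ᶠ[𝓝 x] chartFlow I ψ x₀ x₁ t ∘ extChartAt I x₀ := by
    filter_upwards [(isOpen_extChartAt_source (I := I) x₀).mem_nhds hx] with y hy
    simp only [Function.comp_apply, chartFlow, (extChartAt I x₀).left_inv hy]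
  have h4 := hasMFDerivAt_unique h1 (h2.congr_of_eventuallyEq h3.symm)
  exact DFunLike.congr_fun h4 w

theorem hasDerivAt_chartGenerator (hz : z ∈ (extChartAt I x₀).target) :
    HasDerivAt (fun t ↦ chartFlow I ψ x₀ x₀ t z) (chartGenerator I ψ x₀ z) 0 :=
  (hasDerivAt_prodMk_left ((hψ.contDiffAt_chartFlow hz (hψ.zero_mem_source hz)).differentiableAt
    (by simp))).differentiableAt.hasDerivAt

theorem contDiffAt_chartGenerator (hz : z ∈ (extChartAt I x₀).target) :
    ContDiffAt ℝ ∞ (chartGenerator I ψ x₀) z := by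
  have h1 : ContDiffAt ℝ ∞ (fun y ↦ fderiv ℝ (fun p : ℝ × E ↦ chartFlow I ψ x₀ x₀ p.1 p.2) (0, y)
      (1, 0)) z :=
    (((hψ.contDiffAt_chartFlow hz (hψ.zero_mem_source hz)).fderiv_right (m := ∞) (by simp)).comp z
      (contDiffAt_const.prodMk contDiffAt_id)).clm_apply contDiffAt_const
  refine h1.congr_of_eventuallyEq ?_
  filter_upwards [(isOpen_extChartAt_target (I := I) x₀).mem_nhds hz] with y hy
  exact (hasDerivAt_prodMk_left ((hψ.contDiffAt_chartFlow hy
    (hψ.zero_mem_source hy)).differentiableAt (by simp))).deriv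

/-- The flow equation in charts, with the generator applied first. -/
theorem hasDerivAt_chartFlow (hz : z ∈ (extChartAt I x₀).target)
    (ht : ψ t ((extChartAt I x₀).symm z) ∈ (extChartAt I x₁).source) :
    HasDerivAt (fun s ↦ chartFlow I ψ x₀ x₁ s z)
      (fderiv ℝ (chartFlow I ψ x₀ x₁ t) z (chartGenerator I ψ x₀ z)) t := by
  have h1 : HasDerivAt (fun s ↦ chartFlow I ψ x₀ x₀ (s - t) z) (chartGenerator I ψ x₀ z) t :=
    HasDerivAt.comp_sub_const t t (by rw [sub_self]; exact hψ.hasDerivAt_chartGenerator hz)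
  have h2 := HasFDerivAt.comp_hasDerivAt (l := chartFlow I ψ x₀ x₁ t) t
    (f := fun s ↦ chartFlow I ψ x₀ x₀ (s - t) z) (l' := fderiv ℝ (chartFlow I ψ x₀ x₁ t) z)
    (by rw [sub_self, hψ.chartFlow_zero hz]
        exact (hψ.differentiableAt_chartFlow hz ht).hasFDerivAt) h1
  refine h2.congr_of_eventuallyEq ?_
  have h3 : ∀ᶠ s in 𝓝 t, ψ (s - t) ((extChartAt I x₀).symm z) ∈ (extChartAt I x₀).source := by
    have : ContinuousAt (fun s ↦ s - t) t := by fun_prop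
    refine this.eventually (p := fun s ↦ ψ s ((extChartAt I x₀).symm z) ∈ _) ?_
    rw [show (fun s ↦ s - t) t = 0 from sub_self t]
    exact hψ.eventually_mem_source _ _ (hψ.zero_mem_source hz)
  filter_upwards [h3] with s hs
  simp only [chartFlow, Function.comp_apply]
  rw [(extChartAt I x₀).left_inv hs, ← hψ.add, add_sub_cancel]

variable {v : (x : N) → TangentSpace I x}

/-- Invariance of a vector field under `ψ`, in charts. -/
theorem fderiv_chartFlow_chartField (hv : ∀ t x, mfderiv I I (ψ t) x (v x) = v (ψ t x))
    (hz : z ∈ (extChartAt I x₀).target)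
    (ht : ψ t ((extChartAt I x₀).symm z) ∈ (extChartAt I x₁).source) :
    fderiv ℝ (chartFlow I ψ x₀ x₁ t) z (chartField v x₀ z) =
      chartField v x₁ (chartFlow I ψ x₀ x₁ t z) := by
  have h1 := hψ.fderiv_chartFlow_tangentCoordChange ((extChartAt I x₀).map_target hz) ht
    (v ((extChartAt I x₀).symm z))
  rw [(extChartAt I x₀).right_inv hz, hv] at h1
  rw [chartField, h1, chartField, chartFlow, (extChartAt I x₁).left_inv ht]

theorem fderiv_chartField_chartGenerator
    (hvs : ContMDiff I I.tangent ∞ (fun x ↦ (⟨x, v x⟩ : TangentBundle I N)))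
    (hv : ∀ t x, mfderiv I I (ψ t) x (v x) = v (ψ t x)) (hz : z ∈ (extChartAt I x₀).target) :
    fderiv ℝ (chartField v x₀) z (chartGenerator I ψ x₀ z) =
      fderiv ℝ (chartGenerator I ψ x₀) z (chartField v x₀ z) := by
  have hS : DifferentiableAt ℝ (chartField v x₀) z :=
    ((contDiffOn_chartField hvs x₀).contDiffAt
      ((isOpen_extChartAt_target x₀).mem_nhds hz)).differentiableAt (by simp)
  refine fderiv_comm_of_equivariant (φ := chartFlow I ψ x₀ x₀)
    ((hψ.contDiffAt_chartFlow hz (hψ.zero_mem_source hz)).of_le (WithTop.coe_le_coe.2 le_top))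
    (hψ.chartFlow_zero hz) hS ?_
  filter_upwards [hψ.eventually_mem_source _ _ (hψ.zero_mem_source hz)] with t ht
  exact hψ.fderiv_chartFlow_chartField hv hz ht

/-- If `v` is `ψ`-invariant and `y` is an integral curve of the difference of `v` and the generator
of `ψ`, then `t ↦ ψ t (y t)` is an integral curve of `v`. -/
theorem isMIntegralCurveOn_of_hasDerivWithinAt (hv : ∀ t x, mfderiv I I (ψ t) x (v x) = v (ψ t x))
    {y : ℝ → E} {s : Set ℝ} (hy : ∀ t ∈ s, y t ∈ (extChartAt I x₀).target)
    (hd : ∀ t ∈ s, HasDerivWithinAt y (chartField v x₀ (y t) - chartGenerator I ψ x₀ (y t)) s t) :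
    IsMIntegralCurveOn (fun t ↦ ψ t ((extChartAt I x₀).symm (y t))) v s := by
  intro t ht
  set x₁ := ψ t ((extChartAt I x₀).symm (y t)) with hx₁
  have hsrc : ψ t ((extChartAt I x₀).symm (y t)) ∈ (extChartAt I x₁).source :=
    mem_extChartAt_source x₁
  have h1 := (hψ.contDiffAt_chartFlow (hy t ht) hsrc).differentiableAt (by simp)
  have h2 := HasFDerivAt.comp_hasDerivWithinAt (f := fun t ↦ (t, y t)) t h1.hasFDerivAt
    ((hasDerivWithinAt_id t s).prodMk (hd t ht))
  have h3 : fderiv ℝ (fun p : ℝ × E ↦ chartFlow I ψ x₀ x₁ p.1 p.2) (t, y t)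
      (1, chartField v x₀ (y t) - chartGenerator I ψ x₀ (y t)) = v x₁ := by
    have e1 := (hasDerivAt_prodMk_left h1).unique (hψ.hasDerivAt_chartFlow (hy t ht) hsrc)
    have e2 := hψ.fderiv_chartFlow_chartField hv (hy t ht) hsrc
    have e3 : chartField v x₁ (chartFlow I ψ x₀ x₁ t (y t)) = v x₁ := by
      rw [chartField, chartFlow, (extChartAt I x₁).left_inv hsrc, ← hx₁]
      exact tangentCoordChange_self hsrc
    have e4 : ((1 : ℝ), chartField v x₀ (y t) - chartGenerator I ψ x₀ (y t)) =
        (1, 0) + ((0, chartField v x₀ (y t)) - (0, chartGenerator I ψ x₀ (y t))) := by simp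
    rw [e4, map_add, map_sub, e1, ← e3, ← e2, fderiv_prodMk_right h1]
    simp only [ContinuousLinearMap.comp_apply, ContinuousLinearMap.inr_apply]
    abel
  refine ⟨?_, ?_⟩
  · have h4 : ContinuousWithinAt (fun t ↦ (extChartAt I x₀).symm (y t)) s t :=
      ContinuousAt.comp_continuousWithinAt (f := y) (continuousAt_extChartAt_symm'' (hy t ht))
        (hd t ht).continuousWithinAt
    exact hψ.smooth.continuous.continuousAt.comp_continuousWithinAt
      (f := fun t ↦ (t, (extChartAt I x₀).symm (y t))) (continuousWithinAt_id.prodMk h4)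
  · rw [h3] at h2
    simpa using! h2.hasFDerivWithinAt

end IsSmoothFlow

end Flow

/-! ### Flows on the tangent bundle -/

section Tangent

variable {E : Type*} [NormedAddCommGroup E] [NormedSpace ℝ E]
  {M : Type*} [TopologicalSpace M] [ChartedSpace E M] [IsManifold 𝓘(ℝ, E) ∞ M]

theorem extChartAt_tangent_apply (p q : TangentBundle 𝓘(ℝ, E) M) :
    extChartAt 𝓘(ℝ, E).tangent p q =
      (extChartAt 𝓘(ℝ, E) p.proj q.proj, tangentCoordChange 𝓘(ℝ, E) q.proj p.proj q.proj q.2) :=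
  rfl

theorem mem_extChartAt_tangent_source {p q : TangentBundle 𝓘(ℝ, E) M} :
    q ∈ (extChartAt 𝓘(ℝ, E).tangent p).source ↔
      q.proj ∈ (extChartAt 𝓘(ℝ, E) p.proj).source := by
  simp

theorem mem_extChartAt_tangent_target {p : TangentBundle 𝓘(ℝ, E) M} {z : E × E} :
    z ∈ (extChartAt 𝓘(ℝ, E).tangent p).target ↔ z.1 ∈ (extChartAt 𝓘(ℝ, E) p.proj).target := by
  simp
  exact TangentBundle.mem_chart_target_iff z p

theorem extChartAt_tangent_self (p : TangentBundle 𝓘(ℝ, E) M) (w : E) :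
    extChartAt 𝓘(ℝ, E).tangent p (⟨p.proj, w⟩ : TangentBundle 𝓘(ℝ, E) M) =
      (extChartAt 𝓘(ℝ, E) p.proj p.proj, w) := by
  rw [extChartAt_tangent_apply]
  exact Prod.ext rfl (tangentCoordChange_self (mem_extChartAt_source _))

/-- The natural charts of the tangent bundle represent a second-order field as `(q̇, f)`. -/
theorem coordField_fst {Γ : (p : TangentBundle 𝓘(ℝ, E) M) → TangentSpace 𝓘(ℝ, E).tangent p}
    (hΓ : IsSODE Γ) {p : TangentBundle 𝓘(ℝ, E) M} {z : E × E}
    (hz : z ∈ (extChartAt 𝓘(ℝ, E).tangent p).target) : (coordField Γ p z).1 = z.2 := by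
  set y := (extChartAt 𝓘(ℝ, E).tangent p).symm z with hy
  have hys : y ∈ (extChartAt 𝓘(ℝ, E).tangent p).source :=
    (extChartAt 𝓘(ℝ, E).tangent p).map_target hz
  have h1 := hasMFDerivAt_extChartAt_tangentCoordChange hys
  have h2 : HasMFDerivAt 𝓘(ℝ, E).tangent 𝓘(ℝ, E)
      (fun q : TangentBundle 𝓘(ℝ, E) M ↦ (extChartAt 𝓘(ℝ, E).tangent p q).1) y
      ((ContinuousLinearMap.fst ℝ E E).comp (tangentCoordChange 𝓘(ℝ, E).tangent y p y)) :=
    (hasFDerivAt_fst (𝕜 := ℝ) (E := E) (F := E)).hasMFDerivAt.comp y h1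
  have h3 : HasMFDerivAt 𝓘(ℝ, E).tangent 𝓘(ℝ, E) (fun q : TangentBundle 𝓘(ℝ, E) M ↦ q.proj) y
      (mfderiv 𝓘(ℝ, E).tangent 𝓘(ℝ, E) (fun q : TangentBundle 𝓘(ℝ, E) M ↦ q.proj) y) :=
    ((Bundle.contMDiff_proj (n := ∞)
      (TangentSpace 𝓘(ℝ, E) : M → Type _)).mdifferentiableAt (by simp)).hasMFDerivAt
  have h4 := (hasMFDerivAt_extChartAt_tangentCoordChange
    (mem_extChartAt_tangent_source.1 hys)).comp y h3
  have h5 := DFunLike.congr_fun (hasMFDerivAt_unique h2 h4) (Γ y)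
  refine h5.trans ?_
  have h6 : tangentCoordChange 𝓘(ℝ, E) y.proj p.proj y.proj y.2 = z.2 :=
    congrArg Prod.snd ((extChartAt 𝓘(ℝ, E).tangent p).right_inv hz)
  rw [← h6, ← hΓ.second_order y]
  rfl

variable {ψ : ℝ → M → M} (hψ : IsSmoothFlow 𝓘(ℝ, E) ψ)
include hψ

/-- The tangent lift of a smooth flow. -/
theorem IsSmoothFlow.tangentLift : IsSmoothFlow 𝓘(ℝ, E).tangent
    (fun t p ↦ tangentMap 𝓘(ℝ, E) 𝓘(ℝ, E) (ψ t) p) where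
  smooth := contMDiff_tangentMap_param hψ.smooth
  zero p := by
    have : ψ 0 = id := funext hψ.zero
    rw [this, tangentMap_id]; rfl
  add s t p := by
    have : ψ (s + t) = ψ s ∘ ψ t := funext (hψ.add s t)
    rw [this, tangentMap_comp_at _ ((hψ.contMDiff s).mdifferentiableAt (by simp))
      ((hψ.contMDiff t).mdifferentiableAt (by simp))]

/-- In natural charts, the tangent lift of a flow is the complete lift of its chart expression. -/
theorem IsSmoothFlow.chartFlow_tangentMap {p₀ p₁ : TangentBundle 𝓘(ℝ, E) M} {t : ℝ} {z : E × E}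
    (hz : z ∈ (extChartAt 𝓘(ℝ, E).tangent p₀).target)
    (ht : ψ t ((extChartAt 𝓘(ℝ, E) p₀.proj).symm z.1) ∈ (extChartAt 𝓘(ℝ, E) p₁.proj).source) :
    chartFlow 𝓘(ℝ, E).tangent (fun t p ↦ tangentMap 𝓘(ℝ, E) 𝓘(ℝ, E) (ψ t) p) p₀ p₁ t z =
      liftField (chartFlow 𝓘(ℝ, E) ψ p₀.proj p₁.proj t) z := by
  set y := (extChartAt 𝓘(ℝ, E).tangent p₀).symm z with hy
  have hys : y ∈ (extChartAt 𝓘(ℝ, E).tangent p₀).source :=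
    (extChartAt 𝓘(ℝ, E).tangent p₀).map_target hz
  have h1 : extChartAt 𝓘(ℝ, E).tangent p₀ y = z :=
    (extChartAt 𝓘(ℝ, E).tangent p₀).right_inv hz
  have h2 := hψ.fderiv_chartFlow_tangentCoordChange (mem_extChartAt_tangent_source.1 hys) ht y.2
  have h3 : tangentCoordChange 𝓘(ℝ, E) y.proj p₀.proj y.proj y.2 = z.2 := congrArg Prod.snd h1
  have h4 : extChartAt 𝓘(ℝ, E) p₀.proj y.proj = z.1 := congrArg Prod.fst h1
  rw [h3, h4] at h2
  exact Prod.ext rfl h2.symm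

theorem IsSmoothFlow.chartGenerator_tangentMap {p₀ : TangentBundle 𝓘(ℝ, E) M} {z : E × E}
    (hz : z ∈ (extChartAt 𝓘(ℝ, E).tangent p₀).target) :
    chartGenerator 𝓘(ℝ, E).tangent (fun t p ↦ tangentMap 𝓘(ℝ, E) 𝓘(ℝ, E) (ψ t) p) p₀ z =
      liftField (chartGenerator 𝓘(ℝ, E) ψ p₀.proj) z := by
  have hz1 := mem_extChartAt_tangent_target.1 hz
  have h0 := hψ.zero_mem_source hz1
  have h1 := hψ.hasDerivAt_chartGenerator hz1
  have h2 := hasDerivAt_fderiv_swap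
    ((hψ.contDiffAt_chartFlow hz1 h0).of_le (WithTop.coe_le_coe.2 le_top))
  refine HasDerivAt.deriv ?_
  refine HasDerivAt.congr_of_eventuallyEq
    (h1.prodMk (h2.clm_apply (hasDerivAt_const (0 : ℝ) z.2))) ?_ |>.congr_deriv ?_
  · filter_upwards [hψ.eventually_mem_source _ _ h0] with t ht
    exact hψ.chartFlow_tangentMap hz ht
  · simp [liftField]; rfl

/-- The generator of a flow preserving a second-order field is an infinitesimal symmetry of the
coordinate expression of the field. -/
theorem IsSmoothFlow.isInfinitesimalSymmetryAt
    {Γ : (p : TangentBundle 𝓘(ℝ, E) M) → TangentSpace 𝓘(ℝ, E).tangent p} (hΓ : IsSODE Γ)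
    (hinv : ∀ t p, mfderiv 𝓘(ℝ, E).tangent 𝓘(ℝ, E).tangent
      (tangentMap 𝓘(ℝ, E) 𝓘(ℝ, E) (ψ t)) p (Γ p) =
        Γ (tangentMap 𝓘(ℝ, E) 𝓘(ℝ, E) (ψ t) p))
    {p₀ : TangentBundle 𝓘(ℝ, E) M} {z : E × E}
    (hz : z ∈ (extChartAt 𝓘(ℝ, E).tangent p₀).target) :
    IsInfinitesimalSymmetryAt (coordField Γ p₀) (chartGenerator 𝓘(ℝ, E) ψ p₀.proj) z := by
  have hnhds : ∀ᶠ y in 𝓝 z, y ∈ (extChartAt 𝓘(ℝ, E).tangent p₀).target :=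
    (isOpen_extChartAt_target p₀).mem_nhds hz
  refine ⟨?_, ?_, ?_, ?_⟩
  · exact (((contDiffOn_chartField hΓ.smooth p₀).contDiffAt hnhds).of_le
      (WithTop.coe_le_coe.2 le_top) :)
  · exact (hψ.contDiffAt_chartGenerator (mem_extChartAt_tangent_target.1 hz)).of_le
      (WithTop.coe_le_coe.2 le_top)
  · filter_upwards [hnhds] with y hy using coordField_fst hΓ hy
  · filter_upwards [hnhds.eventually_nhds] with y hy
    have h1 : chartGenerator 𝓘(ℝ, E).tangent
        (fun t p ↦ tangentMap 𝓘(ℝ, E) 𝓘(ℝ, E) (ψ t) p) p₀ =ᶠ[𝓝 y]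
        liftField (chartGenerator 𝓘(ℝ, E) ψ p₀.proj) :=
      hy.mono fun x hx ↦ hψ.chartGenerator_tangentMap hx
    have h2 := hψ.tangentLift.fderiv_chartField_chartGenerator hΓ.smooth hinv hy.self_of_nhds
    rw [h1.fderiv_eq, h1.self_of_nhds] at h2
    exact h2

/-- The complete lift along an orbit `c = ψ t m₀` of the field `Tψ_t (x t)`, in the natural charts
at `(m₀, ċ 0)` and `ċ t`: it is the image under `TTψ_t` of `(x, x' + η' x)`, where `η` is the
generator of the flow. -/
theorem IsSmoothFlow.completeLift_eq {m₀ : M} {x : ℝ → E} {x' : E} {t : ℝ}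
    (hx : HasDerivAt x x' t) :
    completeLift (fun t ↦ ψ t m₀) (fun t ↦ mfderiv 𝓘(ℝ, E) 𝓘(ℝ, E) (ψ t) m₀ (x t)) t =
      fderiv ℝ (liftField (chartFlow 𝓘(ℝ, E) ψ m₀ (ψ t m₀) t))
        (extChartAt 𝓘(ℝ, E) m₀ m₀, chartGenerator 𝓘(ℝ, E) ψ m₀ (extChartAt 𝓘(ℝ, E) m₀ m₀))
        (x t, x' + fderiv ℝ (chartGenerator 𝓘(ℝ, E) ψ m₀) (extChartAt 𝓘(ℝ, E) m₀ m₀) (x t)) := by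
  set q := extChartAt 𝓘(ℝ, E) m₀ m₀ with hq
  set m₁ := ψ t m₀ with hm₁
  have hqt : q ∈ (extChartAt 𝓘(ℝ, E) m₀).target := mem_extChartAt_target m₀
  have hqs : (extChartAt 𝓘(ℝ, E) m₀).symm q = m₀ := extChartAt_to_inv m₀
  have hsrc : ψ t ((extChartAt 𝓘(ℝ, E) m₀).symm q) ∈ (extChartAt 𝓘(ℝ, E) m₁).source := by
    rw [hqs]; exact mem_extChartAt_source m₁
  have hθ := hψ.contDiffAt_chartFlow hqt hsrc
  have hθt : ContDiffAt ℝ ∞ (chartFlow 𝓘(ℝ, E) ψ m₀ m₁ t) q :=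
    hθ.comp q (contDiffAt_const.prodMk contDiffAt_id)
  -- the components, in the chart at `m₁`, of the field at a nearby time
  have hcomp : ∀ s w, ψ s m₀ ∈ (extChartAt 𝓘(ℝ, E) m₁).source →
      tangentCoordChange 𝓘(ℝ, E) (ψ s m₀) m₁ (ψ s m₀) (mfderiv 𝓘(ℝ, E) 𝓘(ℝ, E) (ψ s) m₀ w) =
        fderiv ℝ (chartFlow 𝓘(ℝ, E) ψ m₀ m₁ s) q w := fun s w hs ↦ by
    exact (hψ.fderiv_chartFlow_tangentCoordChange (mem_extChartAt_source m₀) hs w).symm.trans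
      (congrArg _ (tangentCoordChange_self (mem_extChartAt_source m₀)))
  have hev : ∀ᶠ s in 𝓝 t, ψ s m₀ ∈ (extChartAt 𝓘(ℝ, E) m₁).source :=
    hψ.eventually_mem_source _ _ (mem_extChartAt_source m₁)
  have h1 := (hasDerivAt_fderiv_swap (hθ.of_le (WithTop.coe_le_coe.2 le_top))).clm_apply hx
  -- the flow equation turns the mixed derivative into space derivatives
  have h2 : (fun y ↦ deriv (fun s ↦ chartFlow 𝓘(ℝ, E) ψ m₀ m₁ s y) t) =ᶠ[𝓝 q]
      fun y ↦ fderiv ℝ (chartFlow 𝓘(ℝ, E) ψ m₀ m₁ t) y (chartGenerator 𝓘(ℝ, E) ψ m₀ y) := by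
    have h3 : ∀ᶠ y in 𝓝 q, ψ t ((extChartAt 𝓘(ℝ, E) m₀).symm y) ∈
        (extChartAt 𝓘(ℝ, E) m₁).source := by
      have hc : ContinuousAt (fun y ↦ ψ t ((extChartAt 𝓘(ℝ, E) m₀).symm y)) q :=
        ContinuousAt.comp (g := ψ t) (hψ.contMDiff t).continuous.continuousAt
          (continuousAt_extChartAt_symm m₀)
      exact hc.eventually ((isOpen_extChartAt_source m₁).mem_nhds hsrc)
    filter_upwards [(isOpen_extChartAt_target m₀).mem_nhds hqt, h3] with y hy hy'
    exact (hψ.hasDerivAt_chartFlow hy hy').deriv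
  have h4 : HasFDerivAt (fun y ↦ fderiv ℝ (chartFlow 𝓘(ℝ, E) ψ m₀ m₁ t) y
      (chartGenerator 𝓘(ℝ, E) ψ m₀ y)) _ q :=
    ((hθt.fderiv_right (m := ∞) (by simp)).differentiableAt (by simp)).hasFDerivAt.clm_apply
      ((hψ.contDiffAt_chartGenerator hqt).differentiableAt (by simp)).hasFDerivAt
  rw [h2.fderiv_eq, h4.fderiv] at h1
  have h5 : HasDerivAt (fun s ↦ tangentCoordChange 𝓘(ℝ, E) (ψ s m₀) m₁ (ψ s m₀)
      (mfderiv 𝓘(ℝ, E) 𝓘(ℝ, E) (ψ s) m₀ (x s))) _ t := h1.congr_of_eventuallyEq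
    (by filter_upwards [hev] with s hs using hcomp s (x s) hs)
  rw [fderiv_liftField_apply (hθt.of_le (WithTop.coe_le_coe.2 le_top))]
  refine Prod.ext ?_ ?_
  · have h6 := hcomp t (x t) hev.self_of_nhds
    exact (tangentCoordChange_self (mem_extChartAt_source m₁)).symm.trans h6
  · refine h5.deriv.trans ?_
    simp only [add_apply, ContinuousLinearMap.comp_apply, ContinuousLinearMap.flip_apply, map_add]
    abel

end Tangent

/-! ### Velocities of curves in charts -/

section Charts

variable {E : Type*} [NormedAddCommGroup E] [NormedSpace ℝ E]
  {H : Type*} [TopologicalSpace H] {I : ModelWithCorners ℝ E H}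
  {N : Type*} [TopologicalSpace N] [ChartedSpace H N]

/-- The velocity of a curve, read in the preferred chart at its base point. -/
theorem mdifferentiableAt_of_hasDerivAt_extChartAt {f : ℝ → N} {x : N} {s : ℝ} {w : E}
    (h0 : f s = x) (hc : ContinuousAt f s) (hd : HasDerivAt (fun t ↦ extChartAt I x (f t)) w s) :
    MDifferentiableAt 𝓘(ℝ, ℝ) I f s ∧
      (⟨f s, mfderiv 𝓘(ℝ, ℝ) I f s (1 : ℝ)⟩ : TangentBundle I N) = ⟨x, w⟩ := by
  subst h0
  have h : HasMFDerivAt 𝓘(ℝ, ℝ) I f s ((1 : ℝ →L[ℝ] ℝ).smulRight w) := by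
    refine ⟨hc, HasFDerivAt.hasFDerivWithinAt ?_⟩
    exact hd.hasFDerivAt.congr_fderiv (by ext; simp; exact (one_smul ℝ w).symm)
  refine ⟨h.mdifferentiableAt, ?_⟩
  rw [h.mfderiv]
  exact congrArg (Bundle.TotalSpace.mk (f s)) (one_smul ℝ w)

/-- If the orbit of `x₀` is an integral curve of `v`, then the generator of the flow agrees with
`v` at `x₀`. -/
theorem IsSmoothFlow.chartGenerator_eq_chartField [IsManifold I 1 N] {ψ : ℝ → N → N}
    (hψ : IsSmoothFlow I ψ) [I.Boundaryless] {v : (x : N) → TangentSpace I x} {x₀ : N}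
    (h : IsMIntegralCurve (fun t ↦ ψ t x₀) v) :
    chartGenerator I ψ x₀ (extChartAt I x₀ x₀) = chartField v x₀ (extChartAt I x₀ x₀) := by
  have h1 := (h.isMIntegralCurveAt 0).eventually_hasDerivAt.self_of_nhds
  have h2 : ∀ x₁, ψ 0 x₀ = x₁ → HasDerivAt (extChartAt I x₁ ∘ fun t ↦ ψ t x₀)
      (tangentCoordChange I x₁ x₁ x₁ (v x₁)) 0 := by
    rintro _ rfl
    exact h1
  have h3 : (fun t ↦ chartFlow I ψ x₀ x₀ t (extChartAt I x₀ x₀)) =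
      extChartAt I x₀ ∘ fun t ↦ ψ t x₀ := by
    ext t
    simp [chartFlow]
  rw [chartGenerator, h3, (h2 x₀ (hψ.zero x₀)).deriv]
  exact (congrArg (fun y ↦ tangentCoordChange I y x₀ y (v y)) (extChartAt_to_inv x₀)).symm

end Charts

/-! ### Conjugate points along orbits of symmetry flows -/

section Conjugate

variable {E : Type*} [NormedAddCommGroup E] [NormedSpace ℝ E]
  {M : Type*} [TopologicalSpace M] [ChartedSpace E M]

/-- The velocity of an orbit of a flow is transported by the flow. -/
theorem IsSmoothFlow.velocity_orbit {ψ : ℝ → M → M} (hψ : IsSmoothFlow 𝓘(ℝ, E) ψ)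
    (m : M) (t : ℝ) :
    velocity (E := E) (fun t ↦ ψ t m) t =
      tangentMap 𝓘(ℝ, E) 𝓘(ℝ, E) (ψ t) (velocity (E := E) (fun t ↦ ψ t m) 0) := by
  set c : ℝ → M := fun t ↦ ψ t m with hcdef
  have hc : ContMDiff 𝓘(ℝ, ℝ) 𝓘(ℝ, E) ∞ c :=
    hψ.smooth.comp (contMDiff_id.prodMk contMDiff_const)
  have hs : HasMFDerivAt 𝓘(ℝ, ℝ) 𝓘(ℝ, ℝ) (fun s ↦ s - t) t (ContinuousLinearMap.id ℝ ℝ) :=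
    ((hasFDerivAt_id t).sub_const t).hasMFDerivAt
  have h1 : c = ψ t ∘ c ∘ fun s ↦ s - t := by
    ext s
    simp [hcdef, ← hψ.add]
  have h2 : tangentMap 𝓘(ℝ, ℝ) 𝓘(ℝ, ℝ) (fun s ↦ s - t) (⟨t, (1 : ℝ)⟩ : TangentBundle 𝓘(ℝ, ℝ) ℝ) =
      ⟨0, (1 : ℝ)⟩ := by
    refine Bundle.TotalSpace.ext (sub_self t) (heq_of_eq ?_)
    change mfderiv 𝓘(ℝ, ℝ) 𝓘(ℝ, ℝ) (fun s ↦ s - t) t (1 : ℝ) = (1 : ℝ)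
    rw [hs.mfderiv]
    rfl
  change tangentMap 𝓘(ℝ, ℝ) 𝓘(ℝ, E) c (⟨t, (1 : ℝ)⟩ : TangentBundle 𝓘(ℝ, ℝ) ℝ) =
    tangentMap 𝓘(ℝ, E) 𝓘(ℝ, E) (ψ t)
      (tangentMap 𝓘(ℝ, ℝ) 𝓘(ℝ, E) c (⟨0, (1 : ℝ)⟩ : TangentBundle 𝓘(ℝ, ℝ) ℝ))
  conv_lhs => rw [h1]
  rw [tangentMap_comp_at _ ((hψ.contMDiff t).mdifferentiableAt (by simp))
      ((hc.mdifferentiableAt (by simp)).comp _ hs.mdifferentiableAt),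
    tangentMap_comp_at _ (hc.mdifferentiableAt (by simp)) hs.mdifferentiableAt, h2]

variable [IsManifold 𝓘(ℝ, E) ∞ M]

theorem mdifferentiableAt_mk_tangent {m : M} {x : ℝ → E} {x' : E} {t : ℝ} (hx : HasDerivAt x x' t) :
    MDifferentiableAt 𝓘(ℝ, ℝ) 𝓘(ℝ, E).tangent
      (fun t ↦ (⟨m, x t⟩ : TangentBundle 𝓘(ℝ, E) M)) t := by
  refine (mdifferentiableAt_of_hasDerivAt_extChartAt (I := 𝓘(ℝ, E).tangent)
    (w := ((0 : E), x')) rfl ?_ ?_).1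
  · exact ContinuousAt.comp (g := fun w : E ↦ (⟨m, w⟩ : TangentBundle 𝓘(ℝ, E) M))
      (FiberBundle.continuous_totalSpaceMk E _ m).continuousAt hx.continuousAt
  · have h : (fun s ↦ extChartAt 𝓘(ℝ, E).tangent (⟨m, x t⟩ : TangentBundle 𝓘(ℝ, E) M)
        (⟨m, x s⟩ : TangentBundle 𝓘(ℝ, E) M)) = fun s ↦ (extChartAt 𝓘(ℝ, E) m m, x s) :=
      funext fun s ↦ extChartAt_tangent_self ⟨m, x t⟩ (x s)
    rw [h]
    exact (hasDerivAt_const t _).prodMk hx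

variable {ψ : ℝ → M → M} (hψ : IsSmoothFlow 𝓘(ℝ, E) ψ)
include hψ

variable {Γ : (p : TangentBundle 𝓘(ℝ, E) M) → TangentSpace 𝓘(ℝ, E).tangent p} (hΓ : IsSODE Γ)
  (hinv : ∀ t p, mfderiv 𝓘(ℝ, E).tangent 𝓘(ℝ, E).tangent
    (tangentMap 𝓘(ℝ, E) 𝓘(ℝ, E) (ψ t)) p (Γ p) =
      Γ (tangentMap 𝓘(ℝ, E) 𝓘(ℝ, E) (ψ t) p))
  {p₀ : TangentBundle 𝓘(ℝ, E) M}
include hΓ hinv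

/-- Let `Y` solve the linearization, along the zero `p₀`, of `Γ - η^c`, where `η^c` is the generator
of `Tψ`. Then `TTψ_t (Y t)` is a variation field of `Γ` along the orbit of `p₀`: the flow `Tψ`
carries the integral curves of `Γ - η^c` near `p₀` to integral curves of `Γ`. -/
theorem IsSmoothFlow.isVariationFieldOn [FiniteDimensional ℝ E]
    (h0 : liftField (chartGenerator 𝓘(ℝ, E) ψ p₀.proj) (extChartAt 𝓘(ℝ, E).tangent p₀ p₀) =
      coordField Γ p₀ (extChartAt 𝓘(ℝ, E).tangent p₀ p₀))
    {z : ℝ → TangentBundle 𝓘(ℝ, E) M}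
    (hz : ∀ t, z t = tangentMap 𝓘(ℝ, E) 𝓘(ℝ, E) (ψ t) p₀) {Y : ℝ → E × E}
    (hY : ∀ t, HasDerivAt Y (fderiv ℝ (fun y ↦ coordField Γ p₀ y -
      liftField (chartGenerator 𝓘(ℝ, E) ψ p₀.proj) y) (extChartAt 𝓘(ℝ, E).tangent p₀ p₀) (Y t)) t)
    {Z : (t : ℝ) → TangentSpace 𝓘(ℝ, E).tangent (z t)}
    (hZ : ∀ t, Z t = fderiv ℝ (liftField (chartFlow 𝓘(ℝ, E) ψ p₀.proj (z t).proj t))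
      (extChartAt 𝓘(ℝ, E).tangent p₀ p₀) (Y t)) {a b : ℝ} (hab : a < b) :
    IsVariationFieldOn Γ z Z (Icc a b) := by
  set z₀ : E × E := extChartAt 𝓘(ℝ, E).tangent p₀ p₀ with hz₀
  have hz₀t : z₀ ∈ (extChartAt 𝓘(ℝ, E).tangent p₀).target := mem_extChartAt_target p₀
  have hsym := hψ.isInfinitesimalSymmetryAt hΓ hinv hz₀t
  have hO : (extChartAt 𝓘(ℝ, E).tangent p₀).target ∈ 𝓝 z₀ :=
    (isOpen_extChartAt_target p₀).mem_nhds hz₀t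
  obtain ⟨ε, hε, y, hy, hy0⟩ := exists_variation_of_zero
    ((hsym.smooth_field.of_le (by norm_num)).sub
      ((contDiffAt_liftField hsym.smooth_symm).of_le (by norm_num)))
    (by rw [h0, sub_self]) hY hO hab
  refine ⟨ε, hε, fun s t ↦ tangentMap 𝓘(ℝ, E) 𝓘(ℝ, E) (ψ t)
    ((extChartAt 𝓘(ℝ, E).tangent p₀).symm (y s t)), fun s hs ↦ ?_, fun t ht ↦ ?_⟩
  · refine hψ.tangentLift.isMIntegralCurveOn_of_hasDerivWithinAt hinv (fun t ht ↦ (hy s hs t ht).2)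
      fun t ht ↦ ?_
    rw [hψ.chartGenerator_tangentMap (hy s hs t ht).2]
    exact (hy s hs t ht).1
  · obtain ⟨hyd, hyz⟩ := hy0 t ht
    have hpz : tangentMap 𝓘(ℝ, E) 𝓘(ℝ, E) (ψ t)
        ((extChartAt 𝓘(ℝ, E).tangent p₀).symm (y 0 t)) = z t := by
      rw [hyz, hz₀, extChartAt_to_inv, hz]
    have hcs : ContinuousAt (fun s ↦ (extChartAt 𝓘(ℝ, E).tangent p₀).symm (y s t)) 0 :=
      ContinuousAt.comp (g := (extChartAt 𝓘(ℝ, E).tangent p₀).symm)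
        (by rw [hyz]; exact continuousAt_extChartAt_symm p₀) hyd.continuousAt
    have hcz : ContinuousAt (fun s ↦ tangentMap 𝓘(ℝ, E) 𝓘(ℝ, E) (ψ t)
        ((extChartAt 𝓘(ℝ, E).tangent p₀).symm (y s t))) 0 :=
      ContinuousAt.comp (g := tangentMap 𝓘(ℝ, E) 𝓘(ℝ, E) (ψ t))
        (hψ.tangentLift.contMDiff t).continuous.continuousAt hcs
    refine mdifferentiableAt_of_hasDerivAt_extChartAt hpz hcz ?_
    have hzs : ψ t ((extChartAt 𝓘(ℝ, E) p₀.proj).symm z₀.1) ∈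
        (extChartAt 𝓘(ℝ, E) (z t).proj).source := by
      have : ψ t ((extChartAt 𝓘(ℝ, E) p₀.proj).symm z₀.1) = (z t).proj := by
        rw [hz]
        exact congrArg (ψ t) (extChartAt_to_inv p₀.proj)
      rw [this]
      exact mem_extChartAt_source _
    have hθ : ContDiffAt ℝ 5 (chartFlow 𝓘(ℝ, E) ψ p₀.proj (z t).proj t) z₀.1 :=
      ((hψ.contDiffAt_chartFlow (mem_extChartAt_tangent_target.1 hz₀t) hzs).comp z₀.1
        (contDiffAt_const.prodMk contDiffAt_id)).of_le (WithTop.coe_le_coe.2 le_top)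
    have h1 : HasDerivAt
        (fun s ↦ liftField (chartFlow 𝓘(ℝ, E) ψ p₀.proj (z t).proj t) (y s t)) (Z t) 0 := by
      rw [hZ]
      refine HasFDerivAt.comp_hasDerivAt
        (l := liftField (chartFlow 𝓘(ℝ, E) ψ p₀.proj (z t).proj t)) 0 ?_ hyd
      rw [hyz]
      exact ((contDiffAt_liftField hθ).differentiableAt (by norm_num)).hasFDerivAt
    refine h1.congr_of_eventuallyEq ?_
    have h2 : ∀ᶠ s in 𝓝 (0 : ℝ), tangentMap 𝓘(ℝ, E) 𝓘(ℝ, E) (ψ t)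
        ((extChartAt 𝓘(ℝ, E).tangent p₀).symm (y s t)) ∈
          (extChartAt 𝓘(ℝ, E).tangent (z t)).source :=
      hcz.eventually ((isOpen_extChartAt_source (z t)).mem_nhds
        (by beta_reduce; rw [hpz]; exact mem_extChartAt_source _))
    filter_upwards [Ioo_mem_nhds (neg_lt_zero.2 hε) hε, h2] with s hs hs2
    exact hψ.chartFlow_tangentMap (p₁ := z t) (hy s hs t ht).2
      (mem_extChartAt_tangent_source.1 hs2)

/-- A base integral curve of `Γ` that is an orbit of a flow preserving `Γ` has a conjugate point at
every multiple of `π / ν`, when `ν ^ 2` is an eigenvalue of the diagonalizable endomorphism `Φ` at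
the initial velocity, and `Φ` commutes with `∇Φ` there. -/
theorem IsSmoothFlow.isConjugateAt [FiniteDimensional ℝ E]
    (hvel : ∀ t, velocity (fun t ↦ ψ t p₀.proj) t = tangentMap 𝓘(ℝ, E) 𝓘(ℝ, E) (ψ t) p₀)
    (hbase : IsBaseIntegralCurve Γ fun t ↦ ψ t p₀.proj)
    (hcomm : nablaJacobiEndo Γ p₀ * jacobiEndo Γ p₀ = jacobiEndo Γ p₀ * nablaJacobiEndo Γ p₀)
    (hdiag : ⨆ a : ℝ, (jacobiEndo Γ p₀).eigenspace a = ⊤) {ν : ℝ} (hν : 0 < ν)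
    (hev : (jacobiEndo Γ p₀).HasEigenvalue (ν ^ 2)) (k : ℤ) :
    IsConjugateAt Γ (fun t ↦ ψ t p₀.proj) (k * Real.pi / ν) := by
  have : CompleteSpace E := FiniteDimensional.complete ℝ E
  set z₀ : E × E := extChartAt 𝓘(ℝ, E).tangent p₀ p₀ with hz₀
  set η := chartGenerator 𝓘(ℝ, E) ψ p₀.proj with hη
  have hz₀t : z₀ ∈ (extChartAt 𝓘(ℝ, E).tangent p₀).target := mem_extChartAt_target p₀
  have hsym := hψ.isInfinitesimalSymmetryAt hΓ hinv hz₀t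
  -- the orbit of `p₀` under `Tψ` is an integral curve of `Γ`, so `p₀` is a zero of `Γ - η^c`
  have h0 : liftField η z₀ = coordField Γ p₀ z₀ := by
    rw [hη, ← hψ.chartGenerator_tangentMap hz₀t]
    refine hψ.tangentLift.chartGenerator_eq_chartField ?_
    rw [← funext hvel]
    exact hbase
  have hz₀' : z₀ = (extChartAt 𝓘(ℝ, E) p₀.proj p₀.proj, η z₀.1) := by
    refine Prod.ext rfl ?_
    rw [← coordField_fst hΓ hz₀t, ← h0]
    rfl
  set C := connCoeff (coordField Γ p₀) z₀ with hC
  set Φ := jacobiCoeff (coordField Γ p₀) z₀ with hΦ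
  have hnabla := hsym.nabla_jacobiCoeff h0
  have hNΦ : (fderiv ℝ η z₀.1 + C).comp Φ = Φ.comp (fderiv ℝ η z₀.1 + C) := by
    -- `∇Φ` is the commutator of `η' + C` with `Φ`
    have e1 : nablaJacobiEndo Γ p₀ =
        (((fderiv ℝ η z₀.1 + C : E →L[ℝ] E) : E →ₗ[ℝ] E) * (Φ : E →ₗ[ℝ] E) -
          (Φ : E →ₗ[ℝ] E) * ((fderiv ℝ η z₀.1 + C : E →L[ℝ] E) : E →ₗ[ℝ] E) : Module.End ℝ E) :=
      congrArg (fun L : E →L[ℝ] E ↦ (L : E →ₗ[ℝ] E)) hnabla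
    rw [e1] at hcomm
    exact ContinuousLinearMap.coe_injective (mul_comm_of_commutator_commute hdiag hcomm)
  obtain ⟨w, hw⟩ := hev.exists_hasEigenvector
  obtain ⟨e, he⟩ := exists_parallel_eigenvector hNΦ (a := ν ^ 2) (w := w) hw.apply_eq_smul hw.2
  have hY := fun t ↦ hsym.hasDerivAt_linearized_solution h0 (he t).1 (he t).2.1
  set x : ℝ → E := fun t ↦ Real.sin (ν * t) • e t with hxdef
  have hx : ∀ t, HasDerivAt x (Real.sin (ν * t) • -(fderiv ℝ η z₀.1 + C) (e t) +
      (ν * Real.cos (ν * t)) • e t) t := fun t ↦ by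
    have hl : HasDerivAt (fun t : ℝ ↦ Real.sin (ν * t)) (ν * Real.cos (ν * t)) t := by
      simpa [mul_comm] using ((hasDerivAt_id t).const_mul ν).sin
    exact hl.smul (he t).1
  refine ⟨fun t ↦ mfderiv 𝓘(ℝ, E) 𝓘(ℝ, E) (ψ t) p₀.proj (x t), ⟨fun t ↦ ?_, fun a b hab ↦ ?_⟩,
    ⟨Real.pi / 2 / ν, ?_⟩, ?_, ?_⟩
  · have h1 : MDifferentiableAt 𝓘(ℝ, ℝ) (𝓘(ℝ, ℝ).prod 𝓘(ℝ, E).tangent)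
        (fun t ↦ (t, (⟨p₀.proj, x t⟩ : TangentBundle 𝓘(ℝ, E) M))) t :=
      mdifferentiableAt_id.prodMk (mdifferentiableAt_mk_tangent (hx t))
    exact ((hψ.tangentLift.smooth.mdifferentiableAt (by simp)).comp t h1 :)
  · refine hψ.isVariationFieldOn hΓ hinv h0 hvel hY (fun t ↦ ?_) hab
    refine (hψ.completeLift_eq (m₀ := p₀.proj) (hx t)).trans ?_
    -- the derivative of `sin (ν t) e` plus `η'` of it is `ν cos (ν t) e - sin (ν t) C e`
    refine congrArg₂ (fun a b : E × E ↦ fderiv ℝ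
      (liftField (chartFlow 𝓘(ℝ, E) ψ p₀.proj (ψ t p₀.proj) t)) a b) hz₀'.symm (Prod.ext rfl ?_)
    change _ + fderiv ℝ η z₀.1 (x t) = _
    simp only [hxdef, add_apply, map_smul, neg_add, smul_add, smul_neg]
    abel
  -- at time `π / (2 ν)` the field is `Tψ_t (e t)`
  · intro h
    have h1 : ν * (Real.pi / 2 / ν) = Real.pi / 2 := by field_simp
    have h2 : x (Real.pi / 2 / ν) = 0 := hψ.mfderiv_eq_zero_iff.1 h
    simp only [hxdef, h1, Real.sin_pi_div_two, one_smul] at h2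
    exact (he _).2.2 h2
  · exact hψ.mfderiv_eq_zero_iff.2 (show x 0 = 0 by simp [hxdef])
  · have h1 : ν * (k * Real.pi / ν) = k * Real.pi := by field_simp
    have h2 : x (k * Real.pi / ν) = 0 := by
      simp only [hxdef, h1, Real.sin_int_mul_pi, zero_smul]
    exact hψ.mfderiv_eq_zero_iff.2 h2

end Conjugate

end SODE

end

theorem mainTheorem1
    {E : Type*} [NormedAddCommGroup E] [NormedSpace ℝ E] [FiniteDimensional ℝ E]
    {M : Type*} [TopologicalSpace M] [T2Space M] [ChartedSpace E M] [IsManifold 𝓘(ℝ, E) ∞ M]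
    {F : Type*} [NormedAddCommGroup F] [NormedSpace ℝ F] [FiniteDimensional ℝ F]
    {G : Type*} [TopologicalSpace G] [T2Space G] [ChartedSpace F G] [Group G]
    [LieGroup 𝓘(ℝ, F) ∞ G] [ConnectedSpace G]
    [MulAction G M] [ContMDiffSMul 𝓘(ℝ, F) 𝓘(ℝ, E) ∞ G M] [ProperSMul G M]
    (hfree : ∀ (g : G) (m : M), g • m = m → g = 1)
    (Γ : (p : TangentBundle 𝓘(ℝ, E) M) → TangentSpace 𝓘(ℝ, E).tangent p)
    (hΓ : SODE.IsSODE Γ)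
    (hinv : SODE.IsInvariant G Γ)
    (hcomm : ∀ p : TangentBundle 𝓘(ℝ, E) M,
      SODE.nablaJacobiEndo Γ p * SODE.jacobiEndo Γ p =
        SODE.jacobiEndo Γ p * SODE.nablaJacobiEndo Γ p)
    (ξ : GroupLieAlgebra 𝓘(ℝ, F) G) (c : ℝ → M)
    (hc : SODE.IsRelativeEquilibrium Γ ξ c)
    (m₀ : M) (v : TangentSpace 𝓘(ℝ, E) m₀)
    (hv : SODE.velocity (E := E) c 0 = ⟨m₀, v⟩)
    (U : Set (TangentBundle 𝓘(ℝ, E) M)) (hU : (⟨m₀, v⟩ : TangentBundle 𝓘(ℝ, E) M) ∈ U)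
    (hdiag : SODE.IsDiagonalizableOn Γ U)
    (lam : TangentBundle 𝓘(ℝ, E) M → ℝ) (hlam : SODE.IsEigenfunctionOn Γ U lam)
    (hpos : 0 < lam ⟨m₀, v⟩) (k : ℤ) :
    c (k * Real.pi / Real.sqrt (lam ⟨m₀, v⟩)) =
        SODE.lieExp ((k * Real.pi / Real.sqrt (lam ⟨m₀, v⟩)) • ξ) • m₀ ∧
      SODE.IsConjugateAt Γ c (k * Real.pi / Real.sqrt (lam ⟨m₀, v⟩)) := by
  have : CompleteSpace E := FiniteDimensional.complete ℝ E
  have : CompleteSpace F := FiniteDimensional.complete ℝ F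
  obtain ⟨γ, hγ0, hγ⟩ := SODE.exists_isMIntegralCurve_mulInvariantVectorField ξ
  have hc0 : c 0 = m₀ := congrArg Bundle.TotalSpace.proj hv
  have hcγ : c = fun t ↦ γ t • m₀ := by
    rw [← hc0]
    exact SODE.eq_smul_of_isMIntegralCurve_fundamentalField hγ0 hγ hc.group_orbit
  have hψ : SODE.IsSmoothFlow 𝓘(ℝ, E) (fun (t : ℝ) (m : M) ↦ γ t • m) :=
    { smooth := (contMDiff_smul (I := 𝓘(ℝ, F)) (I' := 𝓘(ℝ, E)) (n := ∞) (G := G) (M := M)).comp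
        (((SODE.contMDiff_of_isMIntegralCurve
          (SODE.contMDiff_mulInvariantVectorField_infty ξ) hγ).comp contMDiff_fst).prodMk
          contMDiff_snd)
      zero := fun m ↦ by rw [hγ0, one_smul]
      add := fun s t m ↦ by rw [SODE.map_add_of_isMIntegralCurve hγ0 hγ, mul_smul] }
  have hvel : ∀ t, SODE.velocity (E := E) (fun t ↦ γ t • m₀) t =
      tangentMap 𝓘(ℝ, E) 𝓘(ℝ, E) (fun m : M ↦ γ t • m) ⟨m₀, v⟩ := fun t ↦ by
    rw [← hv, hcγ]
    simpa only [hγ0, one_smul] using hψ.velocity_orbit m₀ t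
  refine ⟨?_, ?_⟩
  · rw [SODE.lieExp_smul_eq hγ0 hγ, hcγ]
  · rw [hcγ]
    refine hψ.isConjugateAt (p₀ := ⟨m₀, v⟩) hΓ (fun t ↦ hinv (γ t)) hvel (hcγ ▸ hc.base)
      (hcomm _) (hdiag.pointwise _ hU) (Real.sqrt_pos.2 hpos) ?_ k
    rw [Real.sq_sqrt hpos.le]
    exact hlam.eigenvalue _ hU
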